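/- **Setting.** Let $\mathcal F$ be the complex vector space with basis the normalised states $|n_1,n_2\rangle$ ($n_1,n_2\in\mathbb N_0$), with annihilation and creation operators $a_\alpha|n\rangle=\sqrt{n_\alpha}\,|n-e_\alpha\rangle$, $a^{\dagger\alpha}|n\rangle=\sqrt{n_\alpha+1}\,|n+e_\alpha\rangle$ ($\alpha=1,2$), and let $\mathcal A=\mathrm{End}(\mathcal F)$. On $\mathcal A$ put $\hat a_\alpha\Psi=a_\alpha\Psi$, $\hat a^{\dagger\alpha}\Psi=a^{\dagger\alpha}\Psi$, $\hat b_\alpha\Psi=\Psi a_\alpha$, $\hat b^{\dagger}_\alpha\Psi=\Psi a^{\dagger\alpha}$, $\hat A=(\hat a_1,\hat a_2,\hat b_1,\hat b_2)^T$, $\hat A^\dagger=(\hat a^{\dagger1},\hat a^{\dagger2},\hat b^\dagger_1,\hat b^\dagger_2)$. Let $\Gamma=\mathrm{diag}(1,1,-1,-1)$ and $su(2,2)=\{X\in M_4(\mathbb C): X^\dagger\Gamma+\Gamma X=0,\ \mathrm{tr}X=0\}$. The fundamental oscillator representation is $\hat X=\hat A^\dagger\Gamma X\hat A$, the dual one is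 $\tilde X=\hat A^\dagger\Gamma(-X^T)\hat A$. With $\eta=\mathrm{diag}(1,-1,-1,-1)$, the Dirac matrices $\gamma^\mu$ in the Dirac basis, $\gamma_\mu=\eta_{\mu\mu}\gamma^\mu$ and $\gamma_5=-i\gamma^0\gamma^1\gamma^2\gamma^3$, put $S_{\mu\nu}=-\frac14[\gamma_\mu,\gamma_\nu]$, $S_{\mu4}=\frac i2\gamma_5\gamma_\mu$, $S_{\mu5}=-\frac i2\gamma_\mu$, $P_\mu=S_{\mu5}+S_{\mu4}$; in either representation $P^2=P_\mu P^\mu$, $W_\mu=\frac12\varepsilon_{\mu\nu\rho\sigma}S^{\nu\rho}P^\sigma$ ($\varepsilon_{0123}=1$), $W^2=W_\mu W^\mu$. A subspace has helicity $h$ if on it $W_\mu=hP_\mu$ holds for the hermitian generators $iS_{\mu\nu},iP_\mu$, i.e. $-W_\mu=ih\,P_\mu$ for the generators above. For $\kappa\in\mathbb N_0$ let $\mathcal A_\kappa$ be the space of all $\Psi\in\mathcal A$ that are normal-ordered power series $\sum c_{n_1n_2m_1m_2}(a^{\dagger1})^{n_1}(a^{\dagger2})^{n_2}(a_1)^{m_1}(a_2)^{m_2}$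 in monomials of chiral parameter $(n_1+n_2)-(m_1+m_2)=\kappa$ (on each vector of $\mathcal F$ only finitely many terms are non-zero), and let $\mathcal A_\kappa^{\rm fin}\subset\mathcal A_\kappa$ be the linear span of these monomials. **Theorem.** Let $\kappa\in\mathbb N_0$. The map $X\mapsto\hat X$ is a representation of $su(2,2)$ on $\mathcal A$, and: 1. $\mathcal A_\kappa^{\rm fin}$ and $\mathcal A_\kappa$ are $su(2,2)$-invariant, and $su(2,2)$ acts irreducibly on $\mathcal A_\kappa^{\rm fin}$. 2. On $\mathcal A_\kappa$ one has $\hat P^2=0$, $\hat W^2=0$, and the helicity is $\kappa/2$. 3. The eigenvalues of $i\hat S_{05}$ on $\mathcal A_\kappa$ are exactly $1+\frac\kappa2+k$, $k\in\mathbb N_0$; the lowest one is $d=1+\kappa/2$. 4. Let $\mathcal V_\kappa$ be the span of the eigenvectors of $i\hat S_{05}$ in $\mathcal A_\kappa$. It consists of Hilbert–Schmidt operators and is $su(2,2)$-invariant; $su(2,2)$ acts on it irreducibly, and by skew-hermitian operators for $\langle\Psi,\Phi\rangle=\mathrm{Tr}(\Psi^\dagger\Phi)$; and the eigenspace of the lowest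 eigenvalue $d$ is the irreducible representation of the block-diagonal $su(2)\oplus su(2)$ with spins $(j_1,j_2)=(\kappa/2,0)$. So $\mathcal V_\kappa$ is the unitary irreducible lowest weight representation of Mack's massless (doubleton) class, $j_1j_2=0$, $d=j_1+j_2+1$, helicity $j_1-j_2=\kappa/2$. The same holds for the dual representation $X\mapsto\tilde X$, with the signs of the energy and of the helicity reversed: $-i\tilde S_{05}$ takes the place of $i\hat S_{05}$ (so the eigenvalues of $i\tilde S_{05}$ on $\mathcal A_\kappa$ are $-(1+\frac\kappa2+k)$), and the helicity is $-\kappa/2$. -/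

import Mathlib

noncomputable section

namespace FuzzyDoubleton

/- The commutator bracket on associative algebras. -/
attribute [local instance 100] LieRing.ofAssociativeRing

/-! ### The Fock space of two oscillators and the algebra of fuzzy functions -/

/-- Occupation numbers `(n₁, n₂)`. -/
abbrev Occ : Type := Fin 2 → ℕ

/-- The Fock space: the complex vector space with basis the normalised states `|n₁, n₂⟩`. -/
def Fock : Type := Occ →₀ ℂ

instance : AddCommGroup Fock := inferInstanceAs (AddCommGroup (Occ →₀ ℂ))

instance : Module ℂ Fock := inferInstanceAs (Module ℂ (Occ →₀ ℂ))

/-- The basis of the Fock space given by the normalised states. -/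
def ketBasis : Module.Basis Occ ℂ Fock := Module.Basis.ofRepr (LinearEquiv.refl ℂ (Occ →₀ ℂ))

/-- The normalised state `|n₁, n₂⟩`. -/
def ket (n : Occ) : Fock := ketBasis n

/-- The annihilation operator `a_α |n⟩ = √n_α |n - e_α⟩` (the vector is `0` when `n_α = 0`). -/
def ann (α : Fin 2) : Module.End ℂ Fock :=
  ketBasis.constr ℂ fun n : Occ => ((√(n α : ℝ) : ℝ) : ℂ) • ket (n - Pi.single α 1)

/-- The creation operator `a^{†α} |n⟩ = √(n_α + 1) |n + e_α⟩`. -/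
def cre (α : Fin 2) : Module.End ℂ Fock :=
  ketBasis.constr ℂ fun n : Occ => ((√((n α : ℝ) + 1) : ℝ) : ℂ) • ket (n + Pi.single α 1)

/-- The algebra of fuzzy functions `𝒜 = End(Fock)`. -/
abbrev Fuzzy : Type := Module.End ℂ Fock

/-- The normal-ordered fuzzy monomial `(a^{†1})^{n₁} (a^{†2})^{n₂} (a₁)^{m₁} (a₂)^{m₂}`. -/
def monomial (n m : Occ) : Fuzzy :=
  cre 0 ^ n 0 * cre 1 ^ n 1 * ann 0 ^ m 0 * ann 1 ^ m 1

/-- The chiral parameter `(n₁ + n₂) - (m₁ + m₂)` of a monomial. -/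
def chirality (n m : Occ) : ℤ := ((n 0 : ℤ) + n 1) - ((m 0 : ℤ) + m 1)

/-- The linear span (finite linear combinations) of the monomials of chiral parameter `κ`. -/
def monoSpan (κ : ℤ) : Submodule ℂ Fuzzy :=
  Submodule.span ℂ {Ψ | ∃ n m : Occ, chirality n m = κ ∧ Ψ = monomial n m}

/-- `Ψ = ∑ c n m • monomial n m` as a normal-ordered power series: on every vector of the Fock
space only finitely many terms are non-zero, and they sum to the value of `Ψ`. -/
def HasExpansion (c : Occ × Occ → ℂ) (Ψ : Fuzzy) : Prop :=
  ∀ v : Fock, (Function.support fun p : Occ × Occ => c p • monomial p.1 p.2 v).Finite ∧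
    Ψ v = ∑ᶠ p : Occ × Occ, c p • monomial p.1 p.2 v

/-- The fuzzy functions of chiral parameter `κ`: all normal-ordered power series in the monomials
of chiral parameter `κ`. -/
def sector (κ : ℤ) : Submodule ℂ Fuzzy where
  carrier := {Ψ | ∃ c : Occ × Occ → ℂ,
    (∀ p, c p ≠ 0 → chirality p.1 p.2 = κ) ∧ HasExpansion c Ψ}
  zero_mem' := ⟨0, by simp, fun v => by simp [Function.support]⟩
  add_mem' := by
    rintro Ψ Φ ⟨c, hc, hΨ⟩ ⟨e, he, hΦ⟩
    refine ⟨c + e, fun p hp => ?_, fun v => ?_⟩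
    · by_cases h : c p = 0
      · exact he p fun h' => hp (by simp [h, h'])
      · exact hc p h
    · have key : (fun p : Occ × Occ => (c + e) p • monomial p.1 p.2 v) =
          fun p => c p • monomial p.1 p.2 v + e p • monomial p.1 p.2 v := by
        funext p
        simp [add_smul]
      rw [key]
      refine ⟨((hΨ v).1.union (hΦ v).1).subset (Function.support_add _ _), ?_⟩
      rw [finsum_add_distrib (hΨ v).1 (hΦ v).1, LinearMap.add_apply, (hΨ v).2, (hΦ v).2]
  smul_mem' := by
    rintro z Ψ ⟨c, hc, hΨ⟩
    refine ⟨z • c, fun p hp => hc p fun h => hp (by simp [h]), fun v => ?_⟩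
    have key : (fun p : Occ × Occ => (z • c) p • monomial p.1 p.2 v) =
        fun p => z • (c p • monomial p.1 p.2 v) := by
      funext p
      simp [mul_smul]
    rw [key]
    refine ⟨(hΨ v).1.subset fun p hp h => hp (by simp only [h, smul_zero]), ?_⟩
    rw [← smul_finsum, LinearMap.smul_apply, (hΨ v).2]

/-- The matrix element `⟨m| Ψ |n⟩`; the states `ket` are orthonormal. -/
def matElem (Ψ : Fuzzy) (m n : Occ) : ℂ := ketBasis.repr (Ψ (ket n)) m

/-- `Ψ` is Hilbert–Schmidt. -/
def IsHS (Ψ : Fuzzy) : Prop :=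
  Summable fun p : Occ × Occ => ‖matElem Ψ p.1 p.2‖ ^ 2

/-- The Hilbert–Schmidt product `⟨Ψ, Φ⟩ = Tr(Ψ† Φ)`. -/
def hsInner (Ψ Φ : Fuzzy) : ℂ :=
  ∑' p : Occ × Occ, (starRingEnd ℂ) (matElem Ψ p.1 p.2) * matElem Φ p.1 p.2

/-! ### The Lie algebra `su(2,2)` and its generators -/

/-- Complex `4 × 4` matrices in `2 × 2` blocks. -/
abbrev Mat : Type := Matrix (Fin 2 ⊕ Fin 2) (Fin 2 ⊕ Fin 2) ℂ

/-- The hermitian form `Γ = diag(1, 1, -1, -1)`. -/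
def Gam : Mat := Matrix.fromBlocks 1 0 0 (-1)

/-- The real Lie algebra `su(2,2)`. -/
def su22 : LieSubalgebra ℝ Mat where
  carrier := {X | X.conjTranspose * Gam + Gam * X = 0 ∧ X.trace = 0}
  zero_mem' := by simp
  add_mem' := by
    rintro X Y ⟨hX, tX⟩ ⟨hY, tY⟩
    refine ⟨?_, by rw [Matrix.trace_add, tX, tY, add_zero]⟩
    have : (X + Y).conjTranspose * Gam + Gam * (X + Y) =
        (X.conjTranspose * Gam + Gam * X) + (Y.conjTranspose * Gam + Gam * Y) := by
      rw [Matrix.conjTranspose_add]; noncomm_ring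
    rw [this, hX, hY, add_zero]
  smul_mem' := by
    rintro r X ⟨hX, tX⟩
    refine ⟨?_, by rw [Matrix.trace_smul, tX, smul_zero]⟩
    have : (r • X).conjTranspose * Gam + Gam * (r • X) =
        r • (X.conjTranspose * Gam + Gam * X) := by
      rw [Matrix.conjTranspose_smul, star_trivial, smul_add, Matrix.smul_mul, Matrix.mul_smul]
    rw [this, hX, smul_zero]
  lie_mem' := by
    rintro X Y ⟨hX, -⟩ ⟨hY, -⟩
    refine ⟨?_, by rw [Ring.lie_def, Matrix.trace_sub, Matrix.trace_mul_comm, sub_self]⟩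
    have hX' : X.conjTranspose * Gam = -(Gam * X) := eq_neg_of_add_eq_zero_left hX
    have hY' : Y.conjTranspose * Gam = -(Gam * Y) := eq_neg_of_add_eq_zero_left hY
    rw [Ring.lie_def, Matrix.conjTranspose_sub, Matrix.conjTranspose_mul,
      Matrix.conjTranspose_mul, sub_mul, mul_assoc, mul_assoc, hX', hY', mul_neg, mul_neg,
      ← mul_assoc, ← mul_assoc, hX', hY']
    noncomm_ring

/-- The Pauli matrices. -/
def pauli : Fin 3 → Matrix (Fin 2) (Fin 2) ℂ :=
  ![!![0, 1; 1, 0], !![0, -Complex.I; Complex.I, 0], !![1, 0; 0, -1]]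

/-- The metric `η = (+ - - -)`. -/
def eta : Fin 4 → ℂ := ![1, -1, -1, -1]

/-- The Dirac matrices `γ^μ` in the Dirac basis. -/
def gammaUp : Fin 4 → Mat :=
  Fin.cons (Matrix.fromBlocks 1 0 0 (-1))
    fun i => Matrix.fromBlocks 0 (pauli i) (-pauli i) 0

/-- The Dirac matrices with lower index, `γ_μ = η_{μμ} γ^μ`. -/
def gam (μ : Fin 4) : Mat := eta μ • gammaUp μ

/-- `γ_5 = -γ^5`, where `γ^5 = i γ^0 γ^1 γ^2 γ^3`. -/
def gam5 : Mat := -(Complex.I • (gammaUp 0 * gammaUp 1 * gammaUp 2 * gammaUp 3))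

/-- The generators `S_{μν}`. -/
def genS (μ ν : Fin 4) : Mat := (-(1 / 4) : ℂ) • (gam μ * gam ν - gam ν * gam μ)

/-- The generators `S_{μ4}`. -/
def genS4 (μ : Fin 4) : Mat := (Complex.I / 2) • (gam5 * gam μ)

/-- The generators `S_{μ5}`. -/
def genS5 (μ : Fin 4) : Mat := (-(Complex.I / 2)) • gam μ

/-- The momenta `P_μ = S_{μ5} + S_{μ4}`. -/
def genP (μ : Fin 4) : Mat := genS5 μ + genS4 μ

/-- The compact subalgebra `su(2) ⊕ su(2)` of `su(2,2)`: block diagonal matrices with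
skew-hermitian traceless blocks. -/
def su2su2 : Set Mat :=
  {X | ∃ A B : Matrix (Fin 2) (Fin 2) ℂ, A.conjTranspose = -A ∧ A.trace = 0 ∧
    B.conjTranspose = -B ∧ B.trace = 0 ∧ X = Matrix.fromBlocks A 0 0 B}

/-! ### The oscillator representations -/

/-- The column `Â = (â_α, b̂^α)` of operators on `𝒜`: `â_α Ψ = a_α Ψ`, `b̂^α Ψ = Ψ a_α`. -/
def oscA : Fin 2 ⊕ Fin 2 → Module.End ℂ Fuzzy :=
  Sum.elim (fun α => LinearMap.mulLeft ℂ (ann α)) (fun α => LinearMap.mulRight ℂ (ann α))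

/-- The row `Â† = (â^{†α}, b̂†_α)`: `â^{†α} Ψ = a^{†α} Ψ`, `b̂†_α Ψ = Ψ a^{†α}`. -/
def oscAdag : Fin 2 ⊕ Fin 2 → Module.End ℂ Fuzzy :=
  Sum.elim (fun α => LinearMap.mulLeft ℂ (cre α)) (fun α => LinearMap.mulRight ℂ (cre α))

/-- The fundamental oscillator representation `X̂ = Â† Γ X Â`. -/
def fundRep (X : Mat) : Module.End ℂ Fuzzy :=
  ∑ i, ∑ j, (Gam * X) i j • (oscAdag i * oscA j)

/-- The dual oscillator representation `X̃ = Ã† Γ X' Ã` with `X' = -Xᵀ`. -/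
def dualRep (X : Mat) : Module.End ℂ Fuzzy := fundRep (-X.transpose)

/-! ### Invariants of a representation `R` by operators on `𝒜` -/

section

variable (R : Mat → Module.End ℂ Fuzzy)

/-- `V` is invariant under the operators `R X`, `X ∈ 𝔤`. -/
def IsInvariant (𝔤 : Set Mat) (V : Submodule ℂ Fuzzy) : Prop :=
  ∀ X ∈ 𝔤, ∀ Ψ ∈ V, R X Ψ ∈ V

/-- `V` is invariant and irreducible under the operators `R X`, `X ∈ 𝔤`. -/
def IsIrred (𝔤 : Set Mat) (V : Submodule ℂ Fuzzy) : Prop :=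
  IsInvariant R 𝔤 V ∧ V ≠ ⊥ ∧
    ∀ U : Submodule ℂ Fuzzy, U ≤ V → IsInvariant R 𝔤 U → U = ⊥ ∨ U = V

/-- The Levi-Civita symbol with `ε_{0123} = 1`. -/
def levi (μ ν ρ σ : Fin 4) : ℂ :=
  (Matrix.of fun i j : Fin 4 => if ![μ, ν, ρ, σ] i = j then (1 : ℂ) else 0).det

/-- `P² = P_μ P^μ`. -/
def massSq : Module.End ℂ Fuzzy := ∑ μ, eta μ • (R (genP μ) * R (genP μ))

/-- The Pauli–Lubanski vector `W_μ = ½ ε_{μνρσ} S^{νρ} P^σ`. -/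
def pauliLub (μ : Fin 4) : Module.End ℂ Fuzzy :=
  (1 / 2 : ℂ) • ∑ ν, ∑ ρ, ∑ σ,
    (levi μ ν ρ σ * eta ν * eta ρ * eta σ) • (R (genS ν ρ) * R (genP σ))

/-- `W² = W_μ W^μ`. -/
def pauliLubSq : Module.End ℂ Fuzzy := ∑ μ, eta μ • (pauliLub R μ * pauliLub R μ)

/-- `V` has helicity `h`: `W_μ = h P_μ` on `V` for the hermitian (physical) generators
`i S_{μν}`, `i P_μ`. In terms of the anti-hermitian ones this reads `-W_μ = h (i P_μ)`. -/
def HasHelicity (V : Submodule ℂ Fuzzy) (h : ℝ) : Prop :=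
  ∀ μ, ∀ Ψ ∈ V, -(pauliLub R μ Ψ) = (h : ℂ) • Complex.I • R (genP μ) Ψ

/-- The conformal energy operator `i S_{05}`. -/
def energy : Module.End ℂ Fuzzy := Complex.I • R (genS5 0)

/-- The eigenvalues of the operator `H` with an eigenvector in `V`. -/
def eigenvaluesOn (H : Module.End ℂ Fuzzy) (V : Submodule ℂ Fuzzy) : Set ℂ :=
  {E | ∃ Ψ ∈ V, Ψ ≠ 0 ∧ H Ψ = E • Ψ}

/-- The span of the eigenvectors of `H` in `V`. -/
def finiteVectors (H : Module.End ℂ Fuzzy) (V : Submodule ℂ Fuzzy) : Submodule ℂ Fuzzy :=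
  Submodule.span ℂ {Ψ | Ψ ∈ V ∧ ∃ E : ℂ, H Ψ = E • Ψ}

/-- The eigenvectors of `H` in `V` with eigenvalue `E`, together with `0`. -/
def eigenspaceIn (H : Module.End ℂ Fuzzy) (V : Submodule ℂ Fuzzy) (E : ℂ) :
    Submodule ℂ Fuzzy :=
  V ⊓ LinearMap.ker (H - E • LinearMap.id)

/-- The Casimir operator `J₁² + J₂² + J₃²` of the first `su(2)`, with `J_k = σ_k / 2`. -/
def casimirLeft : Module.End ℂ Fuzzy :=
  ∑ k, R (Matrix.fromBlocks ((1 / 2 : ℂ) • pauli k) 0 0 0) *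
    R (Matrix.fromBlocks ((1 / 2 : ℂ) • pauli k) 0 0 0)

/-- The Casimir operator `J₁² + J₂² + J₃²` of the second `su(2)`. -/
def casimirRight : Module.End ℂ Fuzzy :=
  ∑ k, R (Matrix.fromBlocks 0 0 0 ((1 / 2 : ℂ) • pauli k)) *
    R (Matrix.fromBlocks 0 0 0 ((1 / 2 : ℂ) • pauli k))

/-- `V` is the irreducible representation of `su(2) ⊕ su(2)` with spins `(j₁, j₂)`. -/
def HasSpins (V : Submodule ℂ Fuzzy) (j₁ j₂ : ℝ) : Prop :=
  IsIrred R su2su2 V ∧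
    (∀ Ψ ∈ V, casimirLeft R Ψ = ((j₁ * (j₁ + 1) : ℝ) : ℂ) • Ψ) ∧
    (∀ Ψ ∈ V, casimirRight R Ψ = ((j₂ * (j₂ + 1) : ℝ) : ℂ) • Ψ)

/-- `V` carries a unitary irreducible representation of `su(2,2)` which is a lowest weight
representation with respect to the energy operator `H` (which is `± i S_{05}`), with lowest
weight `(d; j₁, j₂)`: `V` consists of Hilbert–Schmidt operators, `su(2,2)` acts irreducibly and
by skew-hermitian operators for the Hilbert–Schmidt product, `V` is spanned by eigenvectors of
`H`, all eigenvalues are real with least one `d`, and the lowest eigenspace is the irreducible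
representation of `su(2) ⊕ su(2)` with spins `(j₁, j₂)`. -/
structure IsUnitaryLowestWeight (H : Module.End ℂ Fuzzy) (V : Submodule ℂ Fuzzy)
    (d j₁ j₂ : ℝ) : Prop where
  irred : IsIrred R su22 V
  hilbertSchmidt : ∀ Ψ ∈ V, IsHS Ψ
  unitary : ∀ X ∈ su22, ∀ Ψ ∈ V, ∀ Φ ∈ V, hsInner (R X Ψ) Φ = -hsInner Ψ (R X Φ)
  spanned : finiteVectors H V = V
  real : ∀ E ∈ eigenvaluesOn H V, E.im = 0
  lowest : IsLeast (Complex.re '' eigenvaluesOn H V) d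
  lowestSpins : HasSpins R (eigenspaceIn H V d) j₁ j₂

/-- The classical fuzzy massless field of chiral parameter `κ` in the representation `R`, with
helicity `h` and energy operator `H`. The space `sector κ` consists of the power series in the
monomials of chiral parameter `κ`, and `monoSpan κ` of the finite ones among them; inside
`sector κ` the span of the energy eigenvectors is Mack's representation with `j₁ = κ/2`,
`j₂ = 0`, `d = j₁ + j₂ + 1`. -/
structure IsMasslessField (κ : ℕ) (H : Module.End ℂ Fuzzy) (h : ℝ) : Prop where
  representation : ∃ φ : su22 →ₗ⁅ℝ⁆ Module.End ℂ Fuzzy, ∀ X : su22, φ X = R X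
  span_le : monoSpan κ ≤ sector κ
  span_irred : IsIrred R su22 (monoSpan κ)
  sector_invariant : IsInvariant R su22 (sector κ)
  massless : ∀ Ψ ∈ sector κ, massSq R Ψ = 0
  pauliLub_null : ∀ Ψ ∈ sector κ, pauliLubSq R Ψ = 0
  helicity : HasHelicity R (sector κ) h
  spectrum : eigenvaluesOn H (sector κ) =
    Set.range fun k : ℕ => ((1 + (κ : ℝ) / 2 + k : ℝ) : ℂ)
  doubleton : IsUnitaryLowestWeight R H (finiteVectors H (sector κ))
    (1 + (κ : ℝ) / 2) ((κ : ℝ) / 2) 0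

end

end FuzzyDoubleton

/-!
Commutation with the number operator `N = a^{†α} a_α` grades the fuzzy functions by chirality: a
power series of chirality `κ` is the same thing as an operator `Ψ` with `[N, Ψ] = κ Ψ`. That every
such operator has a normal-ordered expansion is a Taylor formula, obtained by applying the binomial
theorem to `Ψ (a^{†α})^k`, right multiplication by `a^{†α}` being left multiplication plus a
derivation.

The representation operators are bilinears `u_i (Γ X)_{ij} v_j` in four oscillators. On the
normal-ordered monomials, and also on the rank-one operators `(a†)ᵖ|0⟩⟨0|a^q`, these bilinears act
like polynomial differential operators on monomials in two pairs of variables. The complexified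
algebra contains differences of number operators, which separate the members of such a family, and
operators which lower, shift or raise a pair of indices. A non-zero invariant subspace therefore
contains a member of the family, hence one with `q = 0` by lowering, and then all others by shifting
and raising.

The momentum `P_μ` is a product of two spinors built from commuting oscillators, so the Fierz
identities of the Pauli matrices give `P² = 0` and `-W_μ = ½ (u Γ v + 2) i P_μ`. The energy `i S₀₅`
is half the number of left and right quanta, plus one, so its eigenvectors in a sector have the same
span as the rank-one operators of that chirality; there `a_α` and `a^{†α}` are mutually adjoint for
the Hilbert–Schmidt product, which makes the real form `su(2,2)` act by skew-hermitian operators.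

The dual representation is the fundamental one for the canonically transformed oscillators
`(-Γ v, Γ u)`. The transformation changes the sign of `u Γ v + 2`, which is twice the helicity; the
other assertions carry over because `su(2,2)` is stable under `X ↦ -Xᵀ`.
-/

namespace FuzzyDoubleton

/-! ### Multi-indices -/

section MultiIndex

variable {ι : Type*}

lemma exists_eq_add_single [DecidableEq ι] {n : ι → ℕ} {α : ι} (h : n α ≠ 0) :
    ∃ m : ι → ℕ, n = m + Pi.single α 1 := by
  refine ⟨n - Pi.single α 1, (tsub_add_cancel_of_le fun β => ?_).symm⟩
  obtain rfl | hβ := eq_or_ne β α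
  · simpa [Nat.one_le_iff_ne_zero] using h
  · simp [hβ]

variable [Fintype ι]

/-- The degree `|n| = ∑ nᵢ` of a multi-index: the total occupation number. -/
def total (n : ι → ℕ) : ℕ := ∑ i, n i

@[simp] lemma total_eq_zero {n : ι → ℕ} : total n = 0 ↔ n = 0 := by
  simp [total, funext_iff]

lemma total_add (m n : ι → ℕ) : total (m + n) = total m + total n := by
  simp [total, Finset.sum_add_distrib]

variable [DecidableEq ι]

@[simp] lemma total_single (α : ι) (k : ℕ) : total (Pi.single α k : ι → ℕ) = k := by
  simp [total]

lemma total_add_single (n : ι → ℕ) (α : ι) : total (n + Pi.single α 1) = total n + 1 := by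
  rw [total_add, total_single]

lemma exists_eq_add_single_of_total_eq_succ {n : ι → ℕ} {k : ℕ} (h : total n = k + 1) :
    ∃ (m : ι → ℕ) (α : ι), n = m + Pi.single α 1 ∧ total m = k := by
  obtain ⟨α, hα⟩ : ∃ α, n α ≠ 0 := by
    contrapose! h
    simp [total, h]
  obtain ⟨m, rfl⟩ := exists_eq_add_single hα
  exact ⟨m, α, rfl, by simpa [total_add_single] using h⟩

lemma of_total_eq {P : (ι → ℕ) → Prop}
    (hP : ∀ (α β : ι) (m : ι → ℕ), P (m + Pi.single α 1) → P (m + Pi.single β 1)) {p q : ι → ℕ}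
    (hpq : total p = total q) (hp : P p) : P q := by
  induction hk : total q generalizing P p q with
  | zero =>
    rw [total_eq_zero.1 hk]
    rwa [total_eq_zero.1 (hpq.trans hk)] at hp
  | succ k ih =>
    obtain ⟨m, α, rfl, hm⟩ := exists_eq_add_single_of_total_eq_succ (hpq.trans hk)
    obtain ⟨l, β, rfl, hl⟩ := exists_eq_add_single_of_total_eq_succ hk
    refine ih (P := fun m => P (m + Pi.single β 1)) (fun γ δ r hr => ?_) (hm.trans hl.symm)
      (hP α β m hp) hl
    rw [add_right_comm] at hr ⊢
    exact hP γ δ _ hr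

end MultiIndex

/-! ### Invariant subspaces and joint eigenvectors -/

section JointEigenvectors

variable {K W ι τ : Type*} [Field K] [AddCommGroup W] [Module K W] {e : ι → W}
  {T : τ → Module.End K W} {c : τ → ι → K} {U : Submodule K W}

/-- Applying `T k - c k j` removes the `j`-th term and only rescales the others. -/
lemma mem_of_smul_add_sum_smul_mem (hT : ∀ k i, T k (e i) = c k i • e i)
    (hU : ∀ k, ∀ u ∈ U, T k u ∈ U) {i : ι} {s : Finset ι}
    (hs : ∀ j ∈ s, ∃ k, c k i ≠ c k j) {a : K} (ha : a ≠ 0) {f : ι → K}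
    (h : a • e i + ∑ j ∈ s, f j • e j ∈ U) : e i ∈ U := by
  classical
  induction s using Finset.induction_on generalizing a f with
  | empty => exact (U.smul_mem_iff ha).1 (by simpa using h)
  | insert j s hj ih =>
    obtain ⟨k, hk⟩ := hs j (Finset.mem_insert_self j s)
    refine ih (fun l hl => hs l (Finset.mem_insert_of_mem hl)) (mul_ne_zero ha (sub_ne_zero.2 hk))
      (f := fun l => f l * (c k l - c k j)) ?_
    convert U.sub_mem (hU k _ h) (U.smul_mem (c k j) h) using 1
    simp only [Finset.sum_insert hj, map_add, map_sum, map_smul, hT, smul_add, Finset.smul_sum,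
      mul_sub, sub_smul, mul_smul, Finset.sum_sub_distrib, smul_comm (c k j)]
    abel

lemma exists_mem_of_le_span_image (hT : ∀ k i, T k (e i) = c k i • e i) {S : Set ι}
    (hS : ∀ i ∈ S, ∀ j ∈ S, i ≠ j → ∃ k, c k i ≠ c k j) (hU : ∀ k, ∀ u ∈ U, T k u ∈ U)
    (hle : U ≤ Submodule.span K (e '' S)) (hbot : U ≠ ⊥) : ∃ i ∈ S, e i ∈ U := by
  classical
  obtain ⟨u, hu, hu0⟩ := U.exists_mem_ne_zero_of_ne_bot hbot
  obtain ⟨f, hf, rfl⟩ := (Finsupp.mem_span_image_iff_linearCombination K).1 (hle hu)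
  obtain ⟨i, hi⟩ : f.support.Nonempty := by
    rw [Finsupp.support_nonempty_iff]
    rintro rfl
    simp at hu0
  have hfS {j : ι} (hj : j ∈ f.support) : j ∈ S := hf hj
  refine ⟨i, hfS hi, mem_of_smul_add_sum_smul_mem hT hU (s := f.support.erase i) (fun j hj => ?_)
    (Finsupp.mem_support_iff.1 hi) (f := f) ?_⟩
  · have hj := Finset.mem_erase.1 hj
    exact hS i (hfS hi) j (hfS hj.2) hj.1.symm
  · rwa [Finset.add_sum_erase _ (fun j => f j • e j) hi]

end JointEigenvectors

/-! ### Fock families -/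

/-- A Fock family: vectors `e n` on which the operators `x α` and `d α` act as multiplication by,
and differentiation with respect to, the variable `x_α` act on the monomials `xⁿ`. -/
structure IsFock {K ι W : Type*} [Field K] [DecidableEq ι] [AddCommGroup W] [Module K W]
    (e : (ι → ℕ) → W) (x d : ι → Module.End K W) : Prop where
  raise : ∀ α n, x α (e n) = e (n + Pi.single α 1)
  lower : ∀ α n, d α (e n) = (n α : K) • e (n - Pi.single α 1)

namespace IsFock

variable {K ι W : Type*} [Field K] [DecidableEq ι] [AddCommGroup W] [Module K W]
  {e : (ι → ℕ) → W} {x d : ι → Module.End K W}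

lemma lower_add_single (h : IsFock e x d) (α : ι) (n : ι → ℕ) :
    d α (e (n + Pi.single α 1)) = ((n α : K) + 1) • e n := by
  simp [h.lower]

lemma lower_mem (h : IsFock e x d) {U : Submodule K W} {α : ι} {n : ι → ℕ}
    (hU : ∀ m, n = m + Pi.single α 1 → e m ∈ U) : d α (e n) ∈ U := by
  by_cases hn : n α = 0
  · simp [h.lower, hn]
  · obtain ⟨m, rfl⟩ := exists_eq_add_single hn
    rw [h.lower_add_single]
    exact U.smul_mem _ (hU m rfl)

lemma raise_lower (h : IsFock e x d) (α : ι) (n : ι → ℕ) : x α (d α (e n)) = (n α : K) • e n := by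
  by_cases hn : n α = 0
  · simp [h.lower, hn]
  · obtain ⟨m, rfl⟩ := exists_eq_add_single hn
    simp [h.lower_add_single, h.raise]

lemma lower_raise (h : IsFock e x d) (α : ι) (n : ι → ℕ) :
    d α (x α (e n)) = ((n α : K) + 1) • e n := by
  rw [h.raise, h.lower_add_single]

lemma lower_raise_of_ne (h : IsFock e x d) {α β : ι} (hαβ : α ≠ β) (n : ι → ℕ) :
    d α (x β (e n)) = x β (d α (e n)) := by
  by_cases hn : n α = 0
  · simp [h.raise, h.lower, hn, hαβ]
  · obtain ⟨m, rfl⟩ := exists_eq_add_single hn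
    rw [h.raise, add_right_comm, h.lower_add_single, h.lower_add_single, map_smul, h.raise]
    simp [hαβ]

lemma raise_comm (h : IsFock e x d) (α β : ι) (n : ι → ℕ) : x α (x β (e n)) = x β (x α (e n)) := by
  rw [h.raise, h.raise, h.raise, h.raise, add_right_comm]

lemma lower_add (h : IsFock e x d) (α : ι) (m n : ι → ℕ) :
    d α (e (m + n)) =
      (m α : K) • e (m - Pi.single α 1 + n) + (n α : K) • e (m + (n - Pi.single α 1)) := by
  have hm : (m α : K) • e (m - Pi.single α 1 + n) = (m α : K) • e (m + n - Pi.single α 1) := by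
    by_cases h0 : m α = 0
    · simp [h0]
    · obtain ⟨m, rfl⟩ := exists_eq_add_single h0
      rw [add_right_comm, add_tsub_cancel_right, add_tsub_cancel_right]
  have hn : (n α : K) • e (m + (n - Pi.single α 1)) = (n α : K) • e (m + n - Pi.single α 1) := by
    by_cases h0 : n α = 0
    · simp [h0]
    · obtain ⟨n, rfl⟩ := exists_eq_add_single h0
      rw [← add_assoc, add_tsub_cancel_right, add_tsub_cancel_right]
  rw [h.lower, hm, hn, ← add_smul, Pi.add_apply, Nat.cast_add]

lemma raise_pow (h : IsFock e x d) (α : ι) (k : ℕ) (n : ι → ℕ) :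
    (x α ^ k) (e n) = e (n + Pi.single α k) := by
  induction k with
  | zero => simp
  | succ k ih => rw [pow_succ', Module.End.mul_apply, ih, h.raise, add_assoc, ← Pi.single_add]

lemma lower_pow (h : IsFock e x d) (α : ι) (k : ℕ) (n : ι → ℕ) :
    (d α ^ k) (e n) = ((n α).descFactorial k : K) • e (n - Pi.single α k) := by
  induction k with
  | zero => simp
  | succ k ih =>
    rw [pow_succ', Module.End.mul_apply, ih, map_smul, h.lower, smul_smul, tsub_tsub,
      ← Pi.single_add, Nat.descFactorial_succ]
    simp [mul_comm]

lemma raise_lower_mem_span_total [Fintype ι] (h : IsFock e x d) {k : ℕ} {u : W}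
    (hu : u ∈ Submodule.span K (e '' {n | total n = k})) (α β : ι) :
    x α (d β u) ∈ Submodule.span K (e '' {n | total n = k}) := by
  set V := Submodule.span K (e '' {n | total n = k})
  have hle : V ≤ V.comap (x α * d β) := by
    refine Submodule.span_le.2 ?_
    rintro _ ⟨n, hn, rfl⟩
    refine h.lower_mem (U := V.comap (x α)) fun m hm => ?_
    rw [Submodule.mem_comap, h.raise]
    refine Submodule.subset_span ⟨_, ?_, rfl⟩
    rw [Set.mem_ofPred_eq, ← hn, hm, total_add_single, total_add_single]
  exact hle hu

lemma mem_of_add_single_mem [CharZero K] (h : IsFock e x d) {U : Submodule K W} {α β : ι}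
    (hU : ∀ u ∈ U, x β (d α u) ∈ U) {m : ι → ℕ} (hm : e (m + Pi.single α 1) ∈ U) :
    e (m + Pi.single β 1) ∈ U := by
  have hx := hU _ hm
  rw [h.lower_add_single, map_smul, h.raise] at hx
  exact (U.smul_mem_iff (Nat.cast_add_one_ne_zero _)).1 hx

lemma eq_bot_or_eq_span_total [Fintype ι] [CharZero K] (h : IsFock e x d) {k : ℕ}
    {U : Submodule K W} (hle : U ≤ Submodule.span K (e '' {p | total p = k}))
    (hU : ∀ α β, ∀ u ∈ U, x α (d β u) ∈ U) :
    U = ⊥ ∨ U = Submodule.span K (e '' {p | total p = k}) := by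
  refine or_iff_not_imp_left.2 fun hbot => le_antisymm hle ?_
  obtain ⟨p, hp, hpU⟩ := exists_mem_of_le_span_image (T := fun α => x α * d α)
    (c := fun α p => (p α : K)) h.raise_lower
    (fun p _ q _ hpq => by simpa [funext_iff] using hpq) (fun α => hU α α) hle hbot
  rw [Submodule.span_le]
  rintro _ ⟨q, hq, rfl⟩
  exact of_total_eq (P := fun p => e p ∈ U)
    (fun α β m => h.mem_of_add_single_mem (hU β α)) (hp.trans hq.symm) hpU

end IsFock

/-! ### Ladders of two Fock families -/

/-- A ladder: vectors `e p q` forming a Fock family in each of the two multi-indices, for the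
operators `x`, `dx` and `y`, `dy` respectively. -/
structure IsLadder {K ι ι' W : Type*} [Field K] [DecidableEq ι] [DecidableEq ι'] [AddCommGroup W]
    [Module K W] (e : (ι → ℕ) → (ι' → ℕ) → W) (x dx : ι → Module.End K W)
    (y dy : ι' → Module.End K W) : Prop where
  fst : ∀ q, IsFock (fun p => e p q) x dx
  snd : ∀ p, IsFock (e p) y dy

/-- The span of the vectors `e p q` of chirality `|p| - |q| = κ`. -/
def ladderSpan (K : Type*) {ι ι' W : Type*} [Fintype ι] [Fintype ι'] [Field K] [AddCommGroup W]
    [Module K W] (e : (ι → ℕ) → (ι' → ℕ) → W) (κ : ℤ) : Submodule K W :=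
  Submodule.span K ((fun r : (ι → ℕ) × (ι' → ℕ) => e r.1 r.2) ''
    {r | (total r.1 : ℤ) - total r.2 = κ})

section LadderSpan

variable {K ι ι' W : Type*} [Fintype ι] [Fintype ι'] [Field K] [AddCommGroup W] [Module K W]
  {e : (ι → ℕ) → (ι' → ℕ) → W}

lemma mem_ladderSpan {p : ι → ℕ} {q : ι' → ℕ} {κ : ℤ} (h : (total p : ℤ) - total q = κ) :
    e p q ∈ ladderSpan K e κ :=
  Submodule.subset_span ⟨(p, q), h, rfl⟩

lemma ladderSpan_le {κ : ℤ} {U : Submodule K W} :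
    ladderSpan K e κ ≤ U ↔ ∀ p q, (total p : ℤ) - total q = κ → e p q ∈ U := by
  rw [ladderSpan, Submodule.span_le, Set.image_subset_iff]
  exact ⟨fun h p q hpq => h (a := (p, q)) hpq, fun h r hr => h r.1 r.2 hr⟩

lemma ladderSpan_ne_bot [Nonempty ι] (he : ∀ p q, e p q ≠ 0) (k : ℕ) :
    ladderSpan K e k ≠ ⊥ := by
  classical
  obtain ⟨α⟩ := ‹Nonempty ι›
  exact (Submodule.ne_bot_iff _).2
    ⟨e (Pi.single α k) 0, mem_ladderSpan (by simp [total]), he _ _⟩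

end LadderSpan

namespace IsLadder

variable {K ι ι' W : Type*} [Field K] [DecidableEq ι] [DecidableEq ι'] [AddCommGroup W] [Module K W]
  {e : (ι → ℕ) → (ι' → ℕ) → W} {x dx : ι → Module.End K W} {y dy : ι' → Module.End K W}
  [Fintype ι] [Fintype ι'] {κ : ℤ}

lemma x_mem (h : IsLadder e x dx y dy) (α : ι) {w : W} (hw : w ∈ ladderSpan K e κ) :
    x α w ∈ ladderSpan K e (κ + 1) := by
  refine ladderSpan_le (U := (ladderSpan K e (κ + 1)).comap (x α)).2 (fun p q hpq => ?_) hw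
  rw [Submodule.mem_comap, (h.fst q).raise]
  exact mem_ladderSpan (by rw [total_add_single]; omega)

lemma dx_mem (h : IsLadder e x dx y dy) (α : ι) {w : W} (hw : w ∈ ladderSpan K e κ) :
    dx α w ∈ ladderSpan K e (κ - 1) := by
  refine ladderSpan_le (U := (ladderSpan K e (κ - 1)).comap (dx α)).2 (fun p q hpq => ?_) hw
  refine (h.fst q).lower_mem fun m hm => mem_ladderSpan ?_
  rw [hm, total_add_single] at hpq
  omega

lemma y_mem (h : IsLadder e x dx y dy) (α : ι') {w : W} (hw : w ∈ ladderSpan K e κ) :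
    y α w ∈ ladderSpan K e (κ - 1) := by
  refine ladderSpan_le (U := (ladderSpan K e (κ - 1)).comap (y α)).2 (fun p q hpq => ?_) hw
  rw [Submodule.mem_comap, (h.snd p).raise]
  exact mem_ladderSpan (by rw [total_add_single]; omega)

lemma dy_mem (h : IsLadder e x dx y dy) (α : ι') {w : W} (hw : w ∈ ladderSpan K e κ) :
    dy α w ∈ ladderSpan K e (κ + 1) := by
  refine ladderSpan_le (U := (ladderSpan K e (κ + 1)).comap (dy α)).2 (fun p q hpq => ?_) hw
  refine (h.snd p).lower_mem fun m hm => mem_ladderSpan ?_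
  rw [hm, total_add_single] at hpq
  omega

variable {U : Submodule K W}

lemma exists_mem_zero [CharZero K] (h : IsLadder e x dx y dy)
    (hU : ∀ β α, ∀ u ∈ U, dy β (dx α u) ∈ U) {k : ℕ} {p : ι → ℕ} {q : ι' → ℕ}
    (hpq : total p = total q + k) (hmem : e p q ∈ U) : ∃ p₀, total p₀ = k ∧ e p₀ 0 ∈ U := by
  induction hq : total q generalizing p q with
  | zero => exact ⟨p, by omega, total_eq_zero.1 hq ▸ hmem⟩
  | succ l ih =>
    obtain ⟨q, β, rfl, hql⟩ := exists_eq_add_single_of_total_eq_succ hq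
    obtain ⟨p, α, rfl, hpl⟩ := exists_eq_add_single_of_total_eq_succ (k := l + k) (n := p)
      (by omega)
    refine ih (p := p) (q := q) (by omega) ?_ hql
    have hlow := hU β α _ hmem
    rw [(h.fst _).lower_add_single, map_smul, (h.snd p).lower_add_single] at hlow
    simpa only [U.smul_mem_iff (Nat.cast_add_one_ne_zero (R := K) _)] using hlow

lemma mem_of_forall_mem_zero (h : IsLadder e x dx y dy) (hU : ∀ α β, ∀ u ∈ U, x α (y β u) ∈ U)
    {k : ℕ} (h0 : ∀ p, total p = k → e p 0 ∈ U) {p : ι → ℕ} {q : ι' → ℕ}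
    (hpq : total p = total q + k) : e p q ∈ U := by
  induction hq : total q generalizing p q with
  | zero => exact total_eq_zero.1 hq ▸ h0 p (by omega)
  | succ l ih =>
    obtain ⟨q, β, rfl, hql⟩ := exists_eq_add_single_of_total_eq_succ hq
    obtain ⟨p, α, rfl, hpl⟩ := exists_eq_add_single_of_total_eq_succ (k := l + k) (n := p)
      (by omega)
    have hraise := hU α β _ (ih (p := p) (q := q) (by omega) hql)
    rwa [(h.snd p).raise, (h.fst _).raise] at hraise

theorem eq_bot_or_eq_ladderSpan [CharZero K] (h : IsLadder e x dx y dy) {k : ℕ}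
    (hle : U ≤ ladderSpan K e k) (hxdx : ∀ α β, ∀ u ∈ U, x α (dx β u) ∈ U)
    (hxy : ∀ α β, ∀ u ∈ U, x α (y β u) ∈ U) (hdydx : ∀ α β, ∀ u ∈ U, dy α (dx β u) ∈ U)
    (hdyy : ∀ α β, ∀ u ∈ U, dy α (y β u) ∈ U) : U = ⊥ ∨ U = ladderSpan K e k := by
  refine or_iff_not_imp_left.2 fun hbot => le_antisymm hle (ladderSpan_le.2 fun p q hpq => ?_)
  obtain ⟨r, hr, hrU⟩ := exists_mem_of_le_span_image
    (T := Sum.elim (fun α => x α * dx α) fun β => dy β * y β)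
    (c := Sum.elim (fun α r => (r.1 α : K)) fun β r => (r.2 β : K) + 1)
    (by
      rintro (α | β) ⟨p, q⟩
      exacts [(h.fst q).raise_lower α p, (h.snd p).lower_raise β q])
    (fun r _ s _ hrs => by simpa [Prod.ext_iff, funext_iff, imp_iff_not_or] using hrs)
    (by
      rintro (α | β)
      exacts [hxdx α α, hdyy β β]) hle hbot
  obtain ⟨p₀, hp₀, hp₀U⟩ := h.exists_mem_zero hdydx (k := k) (by simp at hr; omega) hrU
  refine h.mem_of_forall_mem_zero hxy (k := k) (fun p hp => ?_) (by omega)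
  exact of_total_eq (P := fun p => e p 0 ∈ U)
    (fun α β m => (h.fst 0).mem_of_add_single_mem (hxdx β α)) (hp₀.trans hp.symm) hp₀U

end IsLadder

/-! ### The Fock space -/

/-- The factorial `n₁! n₂!` of a multi-index. -/
def occFact (n : Occ) : ℕ := ∏ α, (n α).factorial

lemma occFact_add_single (n : Occ) (α : Fin 2) :
    occFact (n + Pi.single α 1) = (n α + 1) * occFact n := by
  fin_cases α <;> simp [occFact, Fin.prod_univ_two, Nat.factorial_succ] <;> ring

lemma occFact_ne_zero (n : Occ) : occFact n ≠ 0 :=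
  Finset.prod_ne_zero_iff.2 fun α _ => (n α).factorial_ne_zero

lemma sqrt_occFact_ne_zero (n : Occ) : ((√(occFact n : ℝ) : ℝ) : ℂ) ≠ 0 := by
  simp [occFact_ne_zero]

lemma sqrt_occFact_mul_self (n : Occ) :
    ((√(occFact n : ℝ) : ℝ) : ℂ) * ((√(occFact n : ℝ) : ℝ) : ℂ) = occFact n := by
  rw [← Complex.ofReal_mul, Real.mul_self_sqrt (Nat.cast_nonneg _), Complex.ofReal_natCast]

/-- The basis of the Fock space given by the unnormalised states `(a†)ⁿ|0⟩`. -/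
def mketBasis : Module.Basis Occ ℂ Fock :=
  ketBasis.unitsSMul fun n => Units.mk0 _ (sqrt_occFact_ne_zero n)

/-- The unnormalised state `(a†)ⁿ|0⟩`. -/
def mket (n : Occ) : Fock := ((√(occFact n : ℝ) : ℝ) : ℂ) • ket n

/-- The unnormalised dual state `⟨0|aⁿ`. -/
def mbra (n : Occ) : Module.Dual ℂ Fock := ((√(occFact n : ℝ) : ℝ) : ℂ) • ketBasis.coord n

@[simp] lemma mketBasis_apply (n : Occ) : mketBasis n = mket n :=
  Module.Basis.unitsSMul_apply n

@[simp] lemma repr_mket (n : Occ) : mketBasis.repr (mket n) = Finsupp.single n 1 := by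
  rw [← mketBasis_apply, Module.Basis.repr_self]

lemma hom_ext_mket {M : Type*} [AddCommGroup M] [Module ℂ M] {f g : Fock →ₗ[ℂ] M}
    (h : ∀ n, f (mket n) = g (mket n)) : f = g :=
  mketBasis.ext fun n => by simpa using h n

lemma mbra_apply (n : Occ) (v : Fock) : mbra n v = occFact n * mketBasis.repr v n := by
  rw [mketBasis, Module.Basis.repr_unitsSMul, ← sqrt_occFact_mul_self]
  simp [mbra, Units.smul_def, mul_assoc, mul_inv_cancel_left₀ (sqrt_occFact_ne_zero n)]

lemma mbra_mket (p q : Occ) : mbra p (mket q) = if p = q then (occFact q : ℂ) else 0 := by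
  rw [mbra_apply, repr_mket, Finsupp.single_apply]
  split_ifs <;> simp_all

lemma ext_mbra {v w : Fock} (h : ∀ n, mbra n v = mbra n w) : v = w :=
  mketBasis.ext_elem fun n => by simpa [mbra_apply, occFact_ne_zero] using h n

lemma cre_mket (α : Fin 2) (n : Occ) : cre α (mket n) = mket (n + Pi.single α 1) := by
  rw [mket, mket, map_smul, ket, cre, Module.Basis.constr_basis, smul_smul, ← Complex.ofReal_mul,
    ← Real.sqrt_mul (Nat.cast_nonneg _), occFact_add_single]
  push_cast
  rw [mul_comm]

lemma ann_mket (α : Fin 2) (n : Occ) :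
    ann α (mket n) = (n α : ℂ) • mket (n - Pi.single α 1) := by
  rw [mket, map_smul, ket, ann, Module.Basis.constr_basis]
  by_cases h : n α = 0
  · simp [h]
  · obtain ⟨m, rfl⟩ := exists_eq_add_single h
    rw [add_tsub_cancel_right, occFact_add_single, mket, smul_smul, smul_smul]
    congr 1
    push_cast
    rw [Real.sqrt_mul (by positivity), Pi.add_apply, Pi.single_eq_same, Nat.cast_add_one,
      Complex.ofReal_mul, mul_right_comm, ← Complex.ofReal_mul, Real.mul_self_sqrt (by positivity)]
    push_cast
    rfl

theorem isFock_mket : IsFock mket cre ann := ⟨cre_mket, ann_mket⟩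

theorem isFock_mbra :
    IsFock mbra (fun α => (ann α).dualMap) fun α => (cre α).dualMap where
  raise α p := hom_ext_mket fun n => by
    by_cases h : n α = 0
    · have hne : p + Pi.single α 1 ≠ n := by
        rintro rfl
        simp at h
      simp [LinearMap.dualMap_apply, ann_mket, mbra_mket, h, hne]
    · obtain ⟨m, rfl⟩ := exists_eq_add_single h
      simp [LinearMap.dualMap_apply, ann_mket, mbra_mket, occFact_add_single]
  lower α p := hom_ext_mket fun n => by
    by_cases h : p α = 0
    · have hne : p ≠ n + Pi.single α 1 := by
        rintro rfl
        simp at h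
      simp [LinearMap.dualMap_apply, cre_mket, mbra_mket, h, hne]
    · obtain ⟨m, rfl⟩ := exists_eq_add_single h
      simp +contextual [LinearMap.dualMap_apply, cre_mket, mbra_mket, occFact_add_single]

lemma mbra_ann (α : Fin 2) (p : Occ) (v : Fock) :
    mbra p (ann α v) = mbra (p + Pi.single α 1) v :=
  LinearMap.congr_fun (isFock_mbra.raise α p) v

lemma mbra_cre (α : Fin 2) (p : Occ) (v : Fock) :
    mbra p (cre α v) = p α * mbra (p - Pi.single α 1) v :=
  LinearMap.congr_fun (isFock_mbra.lower α p) v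

/-! ### Canonical commutation relations -/

lemma cre_mul_comm (α β : Fin 2) : cre α * cre β = cre β * cre α :=
  hom_ext_mket fun n => isFock_mket.raise_comm α β n

lemma ann_mul_comm (α β : Fin 2) : ann α * ann β = ann β * ann α :=
  LinearMap.ext fun v => ext_mbra fun n => by
    simp only [Module.End.mul_apply, mbra_ann, add_right_comm]

lemma ann_mul_cre (α β : Fin 2) :
    ann α * cre β = cre β * ann α + (1 : Matrix (Fin 2) (Fin 2) ℂ) α β • 1 :=
  hom_ext_mket fun n => by
    obtain rfl | h := eq_or_ne α β
    · simp [isFock_mket.lower_raise, isFock_mket.raise_lower, add_smul]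
    · simp [isFock_mket.lower_raise_of_ne h, Matrix.one_apply_ne h]

/-- The product `(a^{†1})^{n₁} (a^{†2})^{n₂}`. -/
def crePow (n : Occ) : Fuzzy := cre 0 ^ n 0 * cre 1 ^ n 1

/-- The product `(a₁)^{m₁} (a₂)^{m₂}`. -/
def annPow (m : Occ) : Fuzzy := ann 0 ^ m 0 * ann 1 ^ m 1

lemma monomial_eq (n m : Occ) : monomial n m = crePow n * annPow m := by
  simp only [monomial, crePow, annPow, mul_assoc]

lemma single_add_single (n : Occ) : Pi.single 0 (n 0) + Pi.single 1 (n 1) = n := by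
  rw [← Fin.sum_univ_two fun α => (Pi.single α (n α) : Occ), Finset.univ_sum_single]

lemma crePow_mket (n m : Occ) : crePow n (mket m) = mket (m + n) := by
  rw [crePow, Module.End.mul_apply, isFock_mket.raise_pow, isFock_mket.raise_pow, add_assoc,
    add_comm (Pi.single 1 _), single_add_single]

lemma mbra_annPow (m p : Occ) (v : Fock) : mbra p (annPow m v) = mbra (p + m) v := by
  have hpow (α : Fin 2) (k : ℕ) (p : Occ) (v : Fock) :
      mbra p ((ann α ^ k) v) = mbra (p + Pi.single α k) v := by
    induction k generalizing p with
    | zero => simp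
    | succ k ih =>
      rw [pow_succ', Module.End.mul_apply, mbra_ann, ih, add_assoc, ← Pi.single_add, add_comm 1]
  rw [annPow, Module.End.mul_apply, hpow, hpow, add_assoc, single_add_single]

lemma annPow_mket (m q : Occ) :
    annPow m (mket q) = (∏ α, (q α).descFactorial (m α) : ℂ) • mket (q - m) := by
  rw [annPow, Module.End.mul_apply, isFock_mket.lower_pow, map_smul, isFock_mket.lower_pow,
    tsub_tsub, add_comm (Pi.single 1 _), single_add_single, smul_smul, Fin.prod_univ_two]
  simp [mul_comm]

lemma cre_mul_crePow (α : Fin 2) (n : Occ) : cre α * crePow n = crePow (n + Pi.single α 1) :=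
  hom_ext_mket fun m => by simp [crePow_mket, cre_mket, add_assoc]

lemma crePow_mul_cre (α : Fin 2) (n : Occ) : crePow n * cre α = crePow (n + Pi.single α 1) :=
  hom_ext_mket fun m => by simp [crePow_mket, cre_mket, add_assoc, add_comm n]

lemma ann_mul_annPow (α : Fin 2) (m : Occ) : ann α * annPow m = annPow (m + Pi.single α 1) :=
  LinearMap.ext fun v => ext_mbra fun p => by
    simp [mbra_annPow, mbra_ann, add_assoc, add_comm m]

lemma annPow_mul_ann (α : Fin 2) (m : Occ) : annPow m * ann α = annPow (m + Pi.single α 1) :=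
  LinearMap.ext fun v => ext_mbra fun p => by simp [mbra_annPow, mbra_ann, add_assoc]

lemma ann_mul_crePow (α : Fin 2) (n : Occ) :
    ann α * crePow n = crePow n * ann α + (n α : ℂ) • crePow (n - Pi.single α 1) :=
  hom_ext_mket fun m => by
    simp [crePow_mket, isFock_mket.lower_add, ann_mket]

lemma annPow_mul_cre (α : Fin 2) (m : Occ) :
    annPow m * cre α = cre α * annPow m + (m α : ℂ) • annPow (m - Pi.single α 1) :=
  LinearMap.ext fun v => ext_mbra fun p => by
    have h := LinearMap.congr_fun (isFock_mbra.lower_add α p m) v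
    simpa [mbra_annPow, mbra_cre, LinearMap.dualMap_apply] using h

/-- The derivation `Ψ ↦ Ψ a^{†α} - a^{†α} Ψ`. -/
def adCre (α : Fin 2) : Module.End ℂ Fuzzy :=
  LinearMap.mulRight ℂ (cre α) - LinearMap.mulLeft ℂ (cre α)

theorem isLadder_monomial :
    IsLadder monomial (fun α => LinearMap.mulLeft ℂ (cre α))
      (fun α => LinearMap.mulLeft ℂ (ann α) - LinearMap.mulRight ℂ (ann α))
      (fun α => LinearMap.mulRight ℂ (ann α)) adCre where
  fst q :=
    { raise α p := by simp [monomial_eq, ← mul_assoc, cre_mul_crePow]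
      lower α p := by
        simp [monomial_eq, ← mul_assoc (ann α), ann_mul_crePow, add_mul, mul_assoc, ann_mul_annPow,
          annPow_mul_ann] }
  snd p :=
    { raise α q := by simp [monomial_eq, mul_assoc, annPow_mul_ann]
      lower α q := by
        simp [adCre, monomial_eq, mul_assoc, annPow_mul_cre, mul_add, ← mul_assoc (cre α),
          ← mul_assoc _ (cre α), cre_mul_crePow, crePow_mul_cre] }

/-- The operator `(a†)ᵖ|0⟩⟨0|a^q`. -/
def rankOne (p q : Occ) : Fuzzy := (mbra q).smulRight (mket p)

lemma rankOne_apply (p q : Occ) (v : Fock) : rankOne p q v = mbra q v • mket p := rfl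

theorem isLadder_rankOne :
    IsLadder rankOne (fun α => LinearMap.mulLeft ℂ (cre α))
      (fun α => LinearMap.mulLeft ℂ (ann α)) (fun α => LinearMap.mulRight ℂ (ann α))
      (fun α => LinearMap.mulRight ℂ (cre α)) where
  fst q :=
    { raise α p := by ext v; simp [rankOne_apply, cre_mket]
      lower α p := by ext v; simp [rankOne_apply, ann_mket, smul_comm (mbra q v)] }
  snd p :=
    { raise α q := by ext v; simp [rankOne_apply, mbra_ann]
      lower α q := by ext v; simp [rankOne_apply, mbra_cre, mul_smul] }

/-! ### The grading by the number operator -/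

/-- The number operator `a^{†1} a₁ + a^{†2} a₂` on the Fock space. -/
def numOp : Fuzzy := ∑ α, cre α * ann α

lemma numOp_mket (n : Occ) : numOp (mket n) = (total n : ℂ) • mket n := by
  simp [numOp, isFock_mket.raise_lower, total, add_smul]

lemma repr_numOp (v : Fock) (n : Occ) :
    mketBasis.repr (numOp v) n = total n * mketBasis.repr v n := by
  suffices h : mketBasis.coord n ∘ₗ numOp = (total n : ℂ) • mketBasis.coord n from
    LinearMap.congr_fun h v
  refine hom_ext_mket fun m => ?_
  obtain rfl | h := eq_or_ne m n
  · simp [numOp_mket]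
  · simp [numOp_mket, h]

lemma mbra_numOp (n : Occ) (v : Fock) : mbra n (numOp v) = total n * mbra n v := by
  simp only [mbra_apply, repr_numOp, mul_left_comm]

lemma repr_eq_zero_of_numOp {r : ℂ} {v : Fock} (hv : numOp v = r • v) {n : Occ}
    (hn : (total n : ℂ) ≠ r) : mketBasis.repr v n = 0 := by
  have h : total n * mketBasis.repr v n = r * mketBasis.repr v n := by
    rw [← repr_numOp, hv, map_smul, Finsupp.smul_apply, smul_eq_mul]
  exact (mul_eq_mul_right_iff.1 h).resolve_left hn

/-- The fuzzy functions which raise the eigenvalues of the number operator by `κ`. -/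
def grade (κ : ℂ) : Submodule ℂ Fuzzy :=
  Module.End.eigenspace (LinearMap.mulLeft ℂ numOp - LinearMap.mulRight ℂ numOp) κ

lemma mem_grade {κ : ℂ} {Ψ : Fuzzy} : Ψ ∈ grade κ ↔ numOp * Ψ = Ψ * numOp + κ • Ψ := by
  rw [grade, Module.End.mem_eigenspace_iff, LinearMap.sub_apply, LinearMap.mulLeft_apply,
    LinearMap.mulRight_apply, sub_eq_iff_eq_add']

lemma mul_mem_grade {κ l : ℂ} {Ψ Φ : Fuzzy} (hΨ : Ψ ∈ grade κ) (hΦ : Φ ∈ grade l) :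
    Ψ * Φ ∈ grade (κ + l) := by
  rw [mem_grade] at *
  rw [← mul_assoc, hΨ, add_mul, mul_assoc, hΦ, mul_add, add_smul, mul_assoc, smul_mul_assoc,
    mul_smul_comm, add_assoc, add_comm (l • _)]

lemma pow_mem_grade {κ : ℂ} {Ψ : Fuzzy} (hΨ : Ψ ∈ grade κ) (n : ℕ) : Ψ ^ n ∈ grade (n * κ) := by
  induction n with
  | zero => simp [mem_grade]
  | succ n ih =>
    rw [pow_succ, Nat.cast_succ, add_one_mul]
    exact mul_mem_grade ih hΨ

lemma cre_mem_grade (α : Fin 2) : cre α ∈ grade 1 :=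
  mem_grade.2 <| hom_ext_mket fun n => by
    simp [cre_mket, numOp_mket, total_add_single, add_smul]

lemma ann_mem_grade (α : Fin 2) : ann α ∈ grade (-1) :=
  mem_grade.2 <| LinearMap.ext fun v => ext_mbra fun n => by
    simp [mbra_ann, mbra_numOp, total_add_single]
    ring

lemma monomial_mem_grade (n m : Occ) : monomial n m ∈ grade (chirality n m) := by
  have h := mul_mem_grade (mul_mem_grade (mul_mem_grade (pow_mem_grade (cre_mem_grade 0) (n 0))
    (pow_mem_grade (cre_mem_grade 1) (n 1))) (pow_mem_grade (ann_mem_grade 0) (m 0)))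
    (pow_mem_grade (ann_mem_grade 1) (m 1))
  rw [monomial]
  convert h using 2
  simp only [chirality]
  push_cast
  ring

lemma adCre_mem_grade {κ : ℂ} {Ψ : Fuzzy} (hΨ : Ψ ∈ grade κ) (α : Fin 2) :
    adCre α Ψ ∈ grade (κ + 1) :=
  Submodule.sub_mem _ (mul_mem_grade hΨ (cre_mem_grade α))
    (add_comm κ 1 ▸ mul_mem_grade (cre_mem_grade α) hΨ)

lemma adCre_pow_mem_grade {κ : ℂ} {Ψ : Fuzzy} (hΨ : Ψ ∈ grade κ) (α : Fin 2) (k : ℕ) :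
    (adCre α ^ k) Ψ ∈ grade (κ + k) := by
  induction k with
  | zero => simpa using hΨ
  | succ k ih =>
    rw [pow_succ', Module.End.mul_apply, Nat.cast_succ, ← add_assoc]
    exact adCre_mem_grade ih α

lemma numOp_apply_of_mem_grade {κ r : ℂ} {Ψ : Fuzzy} (hΨ : Ψ ∈ grade κ) {v : Fock}
    (hv : numOp v = r • v) : numOp (Ψ v) = (r + κ) • Ψ v := by
  rw [← Module.End.mul_apply, mem_grade.1 hΨ, LinearMap.add_apply, Module.End.mul_apply, hv,
    map_smul, LinearMap.smul_apply, add_smul]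

/-! ### Normal-ordered expansions -/

lemma commute_adCre_mulLeft (α : Fin 2) : Commute (adCre α) (LinearMap.mulLeft ℂ (cre α)) :=
  LinearMap.ext fun Ψ => by
    simp [adCre, mul_sub, mul_assoc]

lemma mul_cre_pow (α : Fin 2) (k : ℕ) (Ψ : Fuzzy) :
    Ψ * cre α ^ k =
      ∑ m ∈ Finset.Iic k, (k.choose m : ℂ) • (cre α ^ (k - m) * (adCre α ^ m) Ψ) := by
  have h : LinearMap.mulRight ℂ (cre α) ^ k = ∑ m ∈ Finset.Iic k,
      (k.choose m : ℂ) • (LinearMap.mulLeft ℂ (cre α) ^ (k - m) * adCre α ^ m) := by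
    rw [← sub_add_cancel (LinearMap.mulRight ℂ (cre α)) (LinearMap.mulLeft ℂ (cre α)), ← adCre,
      (commute_adCre_mulLeft α).add_pow, ← Nat.range_succ_eq_Iic]
    refine Finset.sum_congr rfl fun m _ => ?_
    rw [((commute_adCre_mulLeft α).pow_pow m (k - m)).eq, ← Nat.cast_comm, Nat.cast_smul_eq_nsmul,
      nsmul_eq_mul]
  have h := LinearMap.congr_fun h Ψ
  simpa only [LinearMap.pow_mulRight, LinearMap.pow_mulLeft, LinearMap.mulRight_apply,
    LinearMap.sum_apply, LinearMap.smul_apply, Module.End.mul_apply, LinearMap.mulLeft_apply]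
    using h

/-- The value on the vacuum of the iterated derivations `adCre` of `Ψ`; up to factorials, its
coordinates are the coefficients of `aᵐ` in the normal-ordered expansion of `Ψ`. -/
def symbolVec (Ψ : Fuzzy) (m : Occ) : Fock := (adCre 1 ^ m 1) ((adCre 0 ^ m 0) Ψ) (mket 0)

lemma numOp_symbolVec {κ : ℂ} {Ψ : Fuzzy} (hΨ : Ψ ∈ grade κ) (m : Occ) :
    numOp (symbolVec Ψ m) = (κ + total m) • symbolVec Ψ m := by
  have h := numOp_apply_of_mem_grade
    (adCre_pow_mem_grade (adCre_pow_mem_grade hΨ 0 (m 0)) 1 (m 1)) (numOp_mket 0)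
  rw [symbolVec, h]
  simp [total, add_assoc]

lemma sum_Iic_occ {M : Type*} [AddCommMonoid M] (q : Occ) (f : Occ → M) :
    ∑ m ∈ Finset.Iic q, f m = ∑ i ∈ Finset.Iic (q 0), ∑ j ∈ Finset.Iic (q 1), f ![i, j] := by
  rw [← Finset.sum_product']
  refine Finset.sum_equiv (piFinTwoEquiv fun _ => ℕ) (by simp [Pi.le_def, Fin.forall_fin_two])
    fun m _ => congrArg f ?_
  ext α
  fin_cases α <;> rfl

-- The Taylor formula: `mket q` arises from the vacuum by creation operators, and moving these to
-- the left of `Ψ` costs the derivations `adCre`.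
lemma apply_mket_eq_sum (Ψ : Fuzzy) (q : Occ) :
    Ψ (mket q) = ∑ m ∈ Finset.Iic q,
      (∏ α, (q α).choose (m α) : ℂ) • crePow (q - m) (symbolVec Ψ m) := by
  have h : mket q = (cre 0 ^ q 0 * cre 1 ^ q 1) (mket 0) := by
    rw [← crePow, crePow_mket, zero_add]
  simp only [sum_Iic_occ, h, ← Module.End.mul_apply, ← mul_assoc, mul_cre_pow 0, Finset.sum_mul,
    LinearMap.sum_apply]
  refine Finset.sum_congr rfl fun i _ => ?_
  rw [smul_mul_assoc, mul_assoc, mul_cre_pow 1, Finset.mul_sum, Finset.smul_sum,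
    LinearMap.sum_apply]
  simp [crePow, symbolVec, mul_smul, ← mul_assoc]

/-- The coefficients of the normal-ordered expansion. -/
def symbolCoeff (Ψ : Fuzzy) (p : Occ × Occ) : ℂ :=
  (occFact p.2 : ℂ)⁻¹ * mketBasis.repr (symbolVec Ψ p.2) p.1

lemma symbolCoeff_smul_monomial_mket (Ψ : Fuzzy) (n m q : Occ) :
    symbolCoeff Ψ (n, m) • monomial n m (mket q) = (∏ α, (q α).choose (m α) : ℂ) •
      mketBasis.repr (symbolVec Ψ m) n • crePow (q - m) (mket n) := by
  have h : (∏ α, (q α).descFactorial (m α) : ℂ) = occFact m * ∏ α, ((q α).choose (m α) : ℂ) := by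
    simp [occFact, Nat.descFactorial_eq_factorial_mul_choose, Finset.prod_mul_distrib]
  rw [monomial_eq, Module.End.mul_apply, annPow_mket, map_smul, crePow_mket, crePow_mket, smul_smul,
    smul_smul, h, symbolCoeff, add_comm n]
  congr 1
  field_simp [occFact_ne_zero m]

lemma finite_support_and_eq_finsum_of_basis {K ι κ V W : Type*} [Field K] [AddCommGroup V]
    [Module K V] [AddCommGroup W] [Module K W] (b : Module.Basis ι K V) {f : κ → V →ₗ[K] W}
    {g : V →ₗ[K] W}
    (h : ∀ i, (Function.support fun k => f k (b i)).Finite ∧ g (b i) = ∑ᶠ k, f k (b i)) (v : V) :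
    (Function.support fun k => f k v).Finite ∧ g v = ∑ᶠ k, f k v := by
  let L : V →ₗ[K] κ →₀ W :=
    b.constr K fun i => Finsupp.ofSupportFinite (fun k => f k (b i)) (h i).1
  have hL (v : V) (k : κ) : L v k = f k v := by
    suffices hk : Finsupp.lapply k ∘ₗ L = f k from LinearMap.congr_fun hk v
    exact b.ext fun i => by simp [L, Module.Basis.constr_basis, Finsupp.ofSupportFinite_coe]
  have hsum (u : κ →₀ W) :
      Finsupp.lsum K (fun _ : κ => (LinearMap.id : W →ₗ[K] W)) u = ∑ᶠ k, u k := by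
    rw [Finsupp.lsum_apply, Finsupp.sum, finsum_eq_sum_of_support_subset _ u.fun_support_eq.subset]
    rfl
  have hg : g = Finsupp.lsum K (fun _ : κ => (LinearMap.id : W →ₗ[K] W)) ∘ₗ L := b.ext fun i => by
    simp only [(h i).2, LinearMap.comp_apply, hsum, hL]
  simp only [← hL]
  exact ⟨(L v).hasFiniteSupport, by rw [hg, LinearMap.comp_apply, hsum]⟩

lemma finite_support_and_apply_mket_eq_finsum (Ψ : Fuzzy) (q : Occ) :
    (Function.support fun p : Occ × Occ =>
      symbolCoeff Ψ p • monomial p.1 p.2 (mket q)).Finite ∧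
    Ψ (mket q) = ∑ᶠ p : Occ × Occ, symbolCoeff Ψ p • monomial p.1 p.2 (mket q) := by
  classical
  let S : Finset Occ := (Finset.Iic q).biUnion fun m => (mketBasis.repr (symbolVec Ψ m)).support
  have hsupp : (Function.support fun p : Occ × Occ =>
      symbolCoeff Ψ p • monomial p.1 p.2 (mket q)) ⊆ (S ×ˢ Finset.Iic q : Finset (Occ × Occ)) := by
    rintro ⟨n, m⟩ hp
    simp only [Function.mem_support, symbolCoeff_smul_monomial_mket, ne_eq, smul_eq_zero, not_or,
      Finset.prod_eq_zero_iff, Nat.cast_eq_zero, Nat.choose_eq_zero_iff, not_exists, not_and,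
      not_lt, Finset.mem_univ, true_imp_iff] at hp
    simp only [S, Finset.coe_product, Set.mem_prod, Finset.mem_coe, Finset.mem_biUnion,
      Finset.mem_Iic, Finsupp.mem_support_iff]
    exact ⟨⟨m, hp.1, hp.2.1⟩, hp.1⟩
  refine ⟨(Finset.finite_toSet _).subset hsupp, ?_⟩
  rw [finsum_eq_sum_of_support_subset _ hsupp, Finset.sum_product_right, apply_mket_eq_sum]
  refine Finset.sum_congr rfl fun m hm => ?_
  have hS : (mketBasis.repr (symbolVec Ψ m)).support ⊆ S :=
    Finset.subset_biUnion_of_mem (fun m => (mketBasis.repr (symbolVec Ψ m)).support) hm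
  conv_lhs => rw [← mketBasis.linearCombination_repr (symbolVec Ψ m),
    Finsupp.linearCombination_apply, Finsupp.sum_of_support_subset _ hS _ (by simp)]
  simp only [symbolCoeff_smul_monomial_mket, map_sum, map_smul, Finset.smul_sum, mketBasis_apply]

theorem hasExpansion_symbolCoeff (Ψ : Fuzzy) : HasExpansion (symbolCoeff Ψ) Ψ := fun v =>
  finite_support_and_eq_finsum_of_basis mketBasis
    (f := fun p : Occ × Occ => symbolCoeff Ψ p • monomial p.1 p.2)
    (by simpa using finite_support_and_apply_mket_eq_finsum Ψ) v

theorem sector_eq_grade (κ : ℤ) : sector κ = grade κ := by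
  refine le_antisymm ?_ fun Ψ hΨ => ?_
  · rintro Ψ ⟨c, hc, hΨ⟩
    refine mem_grade.2 (hom_ext_mket fun n => ?_)
    suffices h : Ψ (mket n) ∈ Module.End.eigenspace numOp (total n + κ : ℂ) by
      simpa [numOp_mket, add_smul] using Module.End.mem_eigenspace_iff.1 h
    rw [(hΨ (mket n)).2]
    refine finsum_induction (· ∈ Module.End.eigenspace numOp (total n + κ : ℂ)) (zero_mem _)
      (fun _ _ => add_mem) fun p => ?_
    by_cases hp : c p = 0
    · simp [hp]
    · exact Submodule.smul_mem _ _ <| Module.End.mem_eigenspace_iff.2 <|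
        numOp_apply_of_mem_grade (hc p hp ▸ monomial_mem_grade p.1 p.2) (numOp_mket n)
  · refine ⟨symbolCoeff Ψ, fun p hp => ?_, hasExpansion_symbolCoeff Ψ⟩
    contrapose! hp
    rw [symbolCoeff, repr_eq_zero_of_numOp (numOp_symbolVec hΨ p.2), mul_zero]
    contrapose! hp
    have h : (total p.1 : ℤ) = κ + total p.2 := by exact_mod_cast hp
    simp [total, chirality] at h ⊢
    linarith

/-! ### Rank-one operators -/

lemma rankOne_ne_zero (p q : Occ) : rankOne p q ≠ 0 := fun h => by
  have h := congrArg (mbra p) (LinearMap.congr_fun h (mket q))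
  simp [rankOne_apply, mbra_mket, occFact_ne_zero] at h

lemma monomial_ne_zero (n m : Occ) : monomial n m ≠ 0 := fun h => by
  have h := congrArg (mbra n) (LinearMap.congr_fun h (mket m))
  simp [monomial_eq, annPow_mket, crePow_mket, mbra_mket, occFact_ne_zero,
    Nat.descFactorial_eq_zero_iff_lt] at h

lemma numOp_mul_rankOne (p q : Occ) : numOp * rankOne p q = (total p : ℂ) • rankOne p q := by
  ext v
  simp [rankOne_apply, numOp_mket, smul_comm (mbra q v)]

lemma rankOne_mul_numOp (p q : Occ) : rankOne p q * numOp = (total q : ℂ) • rankOne p q := by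
  ext v
  simp [rankOne_apply, mbra_numOp, mul_smul]

lemma ladderSpan_rankOne_le_grade (κ : ℤ) : ladderSpan ℂ rankOne κ ≤ grade κ :=
  ladderSpan_le.2 fun p q hpq => mem_grade.2 <| by
    rw [numOp_mul_rankOne, rankOne_mul_numOp, ← add_smul, ← hpq]
    push_cast
    ring_nf

lemma apply_mket_eq_zero_of_mul_numOp {c : ℂ} {Ψ : Fuzzy} (hΨ : Ψ * numOp = c • Ψ) {q : Occ}
    (hq : (total q : ℂ) ≠ c) : Ψ (mket q) = 0 := by
  have h : (total q : ℂ) • Ψ (mket q) = c • Ψ (mket q) := by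
    rw [← map_smul, ← numOp_mket, ← Module.End.mul_apply, hΨ, LinearMap.smul_apply]
  by_contra h0
  exact hq (smul_left_injective ℂ h0 h)

lemma exists_nat_of_mul_numOp {c : ℂ} {Ψ : Fuzzy} (hΨ : Ψ * numOp = c • Ψ) (h0 : Ψ ≠ 0) :
    ∃ k : ℕ, c = k := by
  contrapose! h0
  exact hom_ext_mket fun q => apply_mket_eq_zero_of_mul_numOp hΨ (h0 _).symm

lemma mem_span_rankOne {κ : ℂ} {k : ℕ} {Ψ : Fuzzy} (hΨ : Ψ ∈ grade κ)
    (hk : Ψ * numOp = (k : ℂ) • Ψ) :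
    Ψ ∈ Submodule.span ℂ ((fun r : Occ × Occ => rankOne r.1 r.2) ''
      {r | total r.2 = k ∧ (total r.1 : ℂ) = k + κ}) := by
  have hsum : Ψ = ∑ q ∈ Finset.piAntidiag Finset.univ k,
      (occFact q : ℂ)⁻¹ • (mbra q).smulRight (Ψ (mket q)) := hom_ext_mket fun n => by
    have hsum : (∑ q ∈ Finset.piAntidiag Finset.univ k,
        (occFact q : ℂ)⁻¹ • (mbra q).smulRight (Ψ (mket q))) (mket n) =
          if total n = k then Ψ (mket n) else 0 := by
      simp [LinearMap.sum_apply, mbra_mket, ite_smul, total, occFact_ne_zero]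
    rw [hsum]
    split_ifs with hn
    · rfl
    · exact apply_mket_eq_zero_of_mul_numOp hk (Nat.cast_injective.ne hn)
  rw [hsum]
  refine Submodule.sum_mem _ fun q hq => Submodule.smul_mem _ _ ?_
  have hq : total q = k := (Finset.mem_piAntidiag.1 hq).1
  have hv : Ψ (mket q) ∈ Submodule.span ℂ (mketBasis '' {p | (total p : ℂ) = k + κ}) := by
    rw [mketBasis.mem_span_image]
    intro p hp
    contrapose! hp
    simpa using repr_eq_zero_of_numOp (numOp_apply_of_mem_grade hΨ (numOp_mket q)) (hq ▸ hp)
  have hmap := Submodule.mem_map_of_mem (f := LinearMap.smulRightₗ (mbra q)) hv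
  rw [Submodule.map_span, Set.image_image] at hmap
  refine Submodule.span_mono ?_ hmap
  rintro _ ⟨p, hp, rfl⟩
  exact ⟨(p, q), ⟨hq, hp⟩, by simp [rankOne]⟩

/-! ### Bilinears in four oscillators -/

lemma Gam_mul_Gam : Gam * Gam = 1 := by
  simp [Gam, Matrix.fromBlocks_multiply]

lemma Gam_mul_mul_apply (X : Mat) (i j : Fin 2 ⊕ Fin 2) : (Gam * X) i j = Gam i i * X i j := by
  rcases i with i | i <;> fin_cases i <;> simp [Gam, Matrix.mul_apply]

lemma Gam_mul_self_apply (i : Fin 2 ⊕ Fin 2) : Gam i i * Gam i i = 1 := by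
  simpa [Gam_mul_mul_apply] using congrFun₂ Gam_mul_Gam i i

lemma Gam_apply_comm (i j : Fin 2 ⊕ Fin 2) : Gam i j = Gam j i := by
  rcases i with i | i <;> rcases j with j | j <;> simp [Gam, Matrix.one_apply, eq_comm]

lemma Gam_mul_Gam_mul_Gam_apply (i j : Fin 2 ⊕ Fin 2) : Gam i i * Gam j j * Gam i j = Gam i j := by
  rcases i with i | i <;> rcases j with j | j <;> simp [Gam, Matrix.one_apply]

section Oscillator

variable {A : Type*} [Ring A] [Algebra ℂ A] {u v : Fin 2 ⊕ Fin 2 → A}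

/-- Four oscillators in the algebra `A`: elements `u`, `v` which satisfy the commutation relations
of `Â†`, `Â`. -/
structure IsOscillator (u v : Fin 2 ⊕ Fin 2 → A) : Prop where
  u_comm (i j : Fin 2 ⊕ Fin 2) : u i * u j = u j * u i
  v_comm (i j : Fin 2 ⊕ Fin 2) : v i * v j = v j * v i
  v_mul_u (i j : Fin 2 ⊕ Fin 2) : v i * u j = u j * v i + Gam i j • 1

/-- The oscillator realisation `u Γ X v` of the matrix `X`. -/
def oscRep (u v : Fin 2 ⊕ Fin 2 → A) : Mat →ₗ[ℂ] A :=
  ∑ i, ∑ j, (Matrix.entryLinearMap ℂ ℂ i j ∘ₗ LinearMap.mulLeft ℂ Gam).smulRight (u i * v j)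

lemma oscRep_apply (u v : Fin 2 ⊕ Fin 2 → A) (X : Mat) :
    oscRep u v X = ∑ i, ∑ j, (Gam * X) i j • (u i * v j) := by
  simp [oscRep]

lemma oscRep_Gam_mul_single (u v : Fin 2 ⊕ Fin 2 → A) (i j : Fin 2 ⊕ Fin 2) :
    oscRep u v (Gam * Matrix.single i j 1) = u i * v j := by
  simp [oscRep_apply, ← mul_assoc, Gam_mul_Gam, Matrix.single_apply, ite_and]

lemma oscRep_mem {V : Submodule ℂ A} (h : ∀ i j, u i * v j ∈ V) (X : Mat) : oscRep u v X ∈ V := by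
  rw [oscRep_apply]
  exact V.sum_mem fun i _ => V.sum_mem fun j _ => V.smul_mem _ (h i j)

lemma hom_ext_Gam_mul_single {M : Type*} [AddCommGroup M] [Module ℂ M] {f g : Mat →ₗ[ℂ] M}
    (h : ∀ i j, f (Gam * Matrix.single i j 1) = g (Gam * Matrix.single i j 1)) : f = g := by
  have hfg : f ∘ₗ LinearMap.mulLeft ℂ Gam = g ∘ₗ LinearMap.mulLeft ℂ Gam :=
    Matrix.ext_linearMap ℂ fun i j => LinearMap.ext_ring (h i j)
  refine LinearMap.ext fun X => ?_
  simpa [← mul_assoc, Gam_mul_Gam] using LinearMap.congr_fun hfg (Gam * X)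

namespace IsOscillator

lemma commutator_mul (h : IsOscillator u v) (i j k l : Fin 2 ⊕ Fin 2) :
    u i * v j * (u k * v l) - u k * v l * (u i * v j) =
      Gam j k • (u i * v l) - Gam l i • (u k * v j) := by
  have h₁ : u i * v j * (u k * v l) = u i * u k * (v j * v l) + Gam j k • (u i * v l) := by
    rw [mul_assoc, ← mul_assoc (v j), h.v_mul_u, add_mul, mul_add, smul_one_mul, mul_smul_comm]
    noncomm_ring
  have h₂ : u k * v l * (u i * v j) = u k * u i * (v l * v j) + Gam l i • (u k * v j) := by
    rw [mul_assoc, ← mul_assoc (v l), h.v_mul_u, add_mul, mul_add, smul_one_mul, mul_smul_comm]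
    noncomm_ring
  rw [h₁, h₂, h.u_comm i k, h.v_comm j l, add_sub_add_left_eq_sub]

theorem oscRep_commutator (h : IsOscillator u v) (X Y : Mat) :
    oscRep u v X * oscRep u v Y - oscRep u v Y * oscRep u v X = oscRep u v (X * Y - Y * X) := by
  have hsingle (i j k l : Fin 2 ⊕ Fin 2) :
      oscRep u v (Gam * Matrix.single i j 1 * (Gam * Matrix.single k l 1)) =
        Gam j k • (u i * v l) := by
    have hmul : Matrix.single i j 1 * Gam * Matrix.single k l 1 =
        Gam j k • Matrix.single i l (1 : ℂ) := by
      simp [Matrix.smul_single]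
    rw [← mul_assoc, mul_assoc Gam, mul_assoc Gam, hmul, mul_smul_comm, map_smul,
      oscRep_Gam_mul_single]
  let L := LinearMap.mul ℂ A
  let M := LinearMap.mul ℂ Mat
  suffices hL : (L - L.flip).compl₁₂ (oscRep u v) (oscRep u v) =
      (M - M.flip).compr₂ (oscRep u v) from LinearMap.congr_fun₂ hL X Y
  refine hom_ext_Gam_mul_single fun i j => hom_ext_Gam_mul_single fun k l => ?_
  simp [L, M, oscRep_Gam_mul_single, hsingle, h.commutator_mul]

/-- The canonical transformation `(u, v) ↦ (-Γ v, Γ u)` of oscillators, which exchanges the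
fundamental and the dual representation. -/
lemma canonical (h : IsOscillator u v) :
    IsOscillator (fun i => -(Gam i i • v i)) (fun i => Gam i i • u i) where
  u_comm i j := by simp only [neg_mul_neg, smul_mul_smul_comm, h.v_comm i j, mul_comm (Gam i i)]
  v_comm i j := by simp only [smul_mul_smul_comm, h.u_comm i j, mul_comm (Gam i i)]
  v_mul_u i j := by
    rw [mul_neg, neg_mul, smul_mul_smul_comm, smul_mul_smul_comm, h.v_mul_u, smul_add, smul_smul,
      mul_comm (Gam j j), Gam_apply_comm j i, Gam_mul_Gam_mul_Gam_apply]
    abel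

lemma oscRep_canonical (h : IsOscillator u v) (X : Mat) :
    oscRep (fun i => -(Gam i i • v i)) (fun i => Gam i i • u i) X =
      oscRep u v (-X.transpose) - X.trace • 1 := by
  suffices hL : oscRep (fun i => -(Gam i i • v i)) (fun i => Gam i i • u i) =
      -oscRep u v ∘ₗ (Matrix.transposeLinearEquiv _ _ ℂ ℂ).toLinearMap -
        (Matrix.traceLinearMap _ ℂ ℂ).smulRight 1 by
    simp [hL]
  refine hom_ext_Gam_mul_single fun i j => ?_
  have hT : (Gam * Matrix.single i j 1).transpose =
      (Gam i i * Gam j j) • (Gam * Matrix.single j i 1) := by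
    ext k l
    simp [Gam_mul_mul_apply, Matrix.single_apply]
    grind [Gam_mul_self_apply]
  have htr : (Gam * Matrix.single i j 1).trace = Gam i j := by
    simp [Matrix.trace_mul_single, Gam_apply_comm j i]
  change _ = -oscRep u v (Gam * Matrix.single i j 1).transpose -
    (Gam * Matrix.single i j 1).trace • (1 : A)
  rw [hT, htr, map_smul, oscRep_Gam_mul_single, oscRep_Gam_mul_single, neg_mul, smul_mul_smul_comm,
    h.v_mul_u, smul_add, smul_smul, Gam_mul_Gam_mul_Gam_apply, neg_add, sub_eq_add_neg]

end IsOscillator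

end Oscillator

/-! ### Fierz identities -/

section Bil

variable {A : Type*} [Ring A] [Algebra ℂ A]

/-- The bilinear expression `u τ v = ∑ τ_{αβ} u_α v_β` of two-component spinors. -/
def bil (τ : Matrix (Fin 2) (Fin 2) ℂ) (u v : Fin 2 → A) : A :=
  ∑ α, ∑ β, τ α β • (u α * v β)

lemma bil_zero (u v : Fin 2 → A) : bil 0 u v = 0 := by
  simp [bil]

lemma bil_neg (τ : Matrix (Fin 2) (Fin 2) ℂ) (u v : Fin 2 → A) : bil (-τ) u v = -bil τ u v := by
  simp [bil, -neg_add_rev, -Fin.sum_univ_two]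

lemma bil_smul (c : ℂ) (τ : Matrix (Fin 2) (Fin 2) ℂ) (u v : Fin 2 → A) :
    bil (c • τ) u v = c • bil τ u v := by
  simp only [bil, Matrix.smul_apply, smul_assoc, Finset.smul_sum]

lemma bil_one (u v : Fin 2 → A) : bil 1 u v = ∑ α, u α * v α := by
  simp [bil, Matrix.one_apply]

lemma bil_sub_left (τ : Matrix (Fin 2) (Fin 2) ℂ) (u u' v : Fin 2 → A) :
    bil τ (u - u') v = bil τ u v - bil τ u' v := by
  simp only [bil, Pi.sub_apply, sub_mul, smul_sub, Finset.sum_sub_distrib]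

lemma bil_sub_right (τ : Matrix (Fin 2) (Fin 2) ℂ) (u v v' : Fin 2 → A) :
    bil τ u (v - v') = bil τ u v - bil τ u v' := by
  simp only [bil, Pi.sub_apply, mul_sub, smul_sub, Finset.sum_sub_distrib]

lemma bil_smul_right (τ : Matrix (Fin 2) (Fin 2) ℂ) (c : ℂ) (u v : Fin 2 → A) :
    bil τ u (c • v) = c • bil τ u v := by
  simp only [bil, Pi.smul_apply, mul_smul_comm, Finset.smul_sum, smul_comm c]

lemma bil_mul_of_commute {a : A} {v : Fin 2 → A} (h : ∀ β, Commute a (v β))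
    (τ : Matrix (Fin 2) (Fin 2) ℂ) (u : Fin 2 → A) :
    bil τ u (fun β => a * v β) = bil τ u v * a := by
  simp only [bil, (h _).eq, Finset.sum_mul, smul_mul_assoc, mul_assoc]

/-- The completeness relation `∑ₖ (σₖ)_{αβ} (σₖ)_{γδ} = 2 δ_{αδ} δ_{βγ} - δ_{αβ} δ_{γδ}`. -/
lemma sum_bil_pauli_mul_bil_pauli (a b c d : Fin 2 → A) :
    ∑ k, bil (pauli k) a b * bil (pauli k) c d =
      (2 : ℂ) • bil 1 a (fun α => bil 1 b c * d α) - bil 1 a b * bil 1 c d := by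
  simp [bil, pauli, Fin.sum_univ_three, mul_add, add_mul, mul_assoc, smul_smul]
  module

/-- The relation `i (σⱼ ⊗ σₖ - σₖ ⊗ σⱼ) = (1 ⊗ σᵢ - σᵢ ⊗ 1) Π`, where `Π` is the exchange of the two
factors and `(i, j, k)` is a cyclic permutation of the three indices. -/
lemma bil_pauli_mul_bil_pauli_sub (i : Fin 3) (a b c d : Fin 2 → A) :
    Complex.I • (bil (pauli (i + 1)) a b * bil (pauli (i + 2)) c d -
        bil (pauli (i + 2)) a b * bil (pauli (i + 1)) c d) =
      bil 1 a (fun α => bil (pauli i).transpose b c * d α) -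
        bil (pauli i) a (fun α => bil 1 b c * d α) := by
  fin_cases i <;>
  · simp only [bil, pauli, Fin.zero_eta, Fin.mk_one, Fin.reduceFinMk, Fin.isValue, Fin.reduceAdd,
      Fin.sum_univ_two, Matrix.of_apply, Matrix.cons_val, Matrix.cons_val', Matrix.cons_val_zero,
      Matrix.cons_val_one, Matrix.cons_val_fin_one, Matrix.transpose_apply, Matrix.one_apply_eq,
      ne_eq, zero_ne_one, one_ne_zero, not_false_eq_true, Matrix.one_apply_ne, zero_add,
      zero_smul, one_smul, add_zero, neg_smul, mul_add, add_mul, mul_assoc, neg_mul, mul_neg,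
      Algebra.smul_mul_assoc, Algebra.mul_smul_comm, smul_add, smul_neg]
    match_scalars <;> grind [Complex.I_sq]

end Bil

/-- The relations between the derivations `dx`, the variables `y` and the derivations `dy` in an
algebra of differential operators in two pairs of variables `x`, `y`. -/
structure IsWeyl {A : Type*} [Ring A] [Algebra ℂ A] (dx y dy : Fin 2 → A) : Prop where
  dx_dx (α β : Fin 2) : Commute (dx α) (dx β)
  dy_dy (α β : Fin 2) : Commute (dy α) (dy β)
  dx_dy (α β : Fin 2) : Commute (dx α) (dy β)
  dy_y (α β : Fin 2) : dy α * y β = y β * dy α + (1 : Matrix (Fin 2) (Fin 2) ℂ) α β • 1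

namespace IsWeyl

variable {A : Type*} [Ring A] [Algebra ℂ A] {dx y dy : Fin 2 → A}

lemma bil_transpose_dx_dy (h : IsWeyl dx y dy) (τ : Matrix (Fin 2) (Fin 2) ℂ) :
    bil τ.transpose dx dy = bil τ dy dx := by
  rw [bil, bil, Finset.sum_comm]
  simp only [Matrix.transpose_apply, (h.dx_dy _ _).eq]

lemma bil_transpose_y_dy (h : IsWeyl dx y dy) (τ : Matrix (Fin 2) (Fin 2) ℂ) :
    bil τ.transpose y dy = bil τ dy y - τ.trace • 1 := by
  rw [bil, bil, Finset.sum_comm]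
  simp [h.dy_y, Finset.sum_add_distrib, ← Finset.sum_smul, Matrix.trace,
    Matrix.one_apply]

lemma commute_dx (h : IsWeyl dx y dy) (τ : Matrix (Fin 2) (Fin 2) ℂ) (γ : Fin 2) :
    Commute (bil τ dy dx) (dx γ) :=
  Commute.sum_left _ _ _ fun α _ => Commute.sum_left _ _ _ fun β _ =>
    (((h.dx_dy γ α).symm.mul_left (h.dx_dx β γ)).smul_left _)

lemma commute_dy (h : IsWeyl dx y dy) (τ : Matrix (Fin 2) (Fin 2) ℂ) (γ : Fin 2) :
    Commute (bil τ dy dx) (dy γ) :=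
  Commute.sum_left _ _ _ fun α _ => Commute.sum_left _ _ _ fun β _ =>
    (((h.dy_dy α γ).mul_left (h.dx_dy β γ)).smul_left _)

lemma commute_bil (h : IsWeyl dx y dy) (τ ρ : Matrix (Fin 2) (Fin 2) ℂ) :
    Commute (bil τ dy dx) (bil ρ dy dx) :=
  Commute.sum_right _ _ _ fun α _ => Commute.sum_right _ _ _ fun β _ =>
    (((h.commute_dy τ α).mul_right (h.commute_dx τ β)).smul_right _)

lemma bil_dy_bil_dy_y_mul (h : IsWeyl dx y dy) (τ ρ : Matrix (Fin 2) (Fin 2) ℂ) (d : Fin 2 → A) :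
    bil τ dy (fun β => bil ρ dy y * d β) = bil ρ dy y * bil τ dy d + bil (ρ * τ) dy d := by
  have hdy (α : Fin 2) : dy α * bil ρ dy y = bil ρ dy y * dy α + ∑ γ, ρ γ α • dy γ := by
    have hterm (γ δ : Fin 2) : dy α * (dy γ * y δ) =
        dy γ * y δ * dy α + (1 : Matrix (Fin 2) (Fin 2) ℂ) α δ • dy γ := by
      rw [← mul_assoc, (h.dy_dy α γ).eq, mul_assoc, h.dy_y, mul_add, mul_smul_comm, mul_one,
        mul_assoc]
    simp only [bil, Finset.mul_sum, Finset.sum_mul, mul_smul_comm, smul_mul_assoc, hterm,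
      smul_add, Finset.sum_add_distrib, Matrix.one_apply, ite_smul, one_smul, zero_smul, smul_ite,
      smul_zero, Finset.sum_ite_eq, Finset.mem_univ, if_true]
  generalize bil ρ dy y = E at hdy ⊢
  simp only [bil, ← mul_assoc, hdy]
  simp [Matrix.mul_apply, add_mul, mul_add, mul_assoc, add_smul, mul_smul]
  module

lemma sum_bil_pauli_dx_mul (h : IsWeyl dx y dy) (x : Fin 2 → A) :
    ∑ k, bil (pauli k) x dx * bil (pauli k) dy dx = bil 1 x dx * bil 1 dy dx := by
  have h₁ : bil 1 dx dy = bil 1 dy dx := by simpa using h.bil_transpose_dx_dy 1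
  rw [sum_bil_pauli_mul_bil_pauli, h₁, bil_mul_of_commute (h.commute_dx 1)]
  module

lemma bil_dy_one_mul (h : IsWeyl dx y dy) (τ : Matrix (Fin 2) (Fin 2) ℂ) (d : Fin 2 → A) :
    bil τ dy (fun β => bil 1 y dy * d β) = bil 1 dy y * bil τ dy d - bil τ dy d := by
  have h₁ : bil 1 y dy = bil 1 dy y - (2 : ℂ) • 1 := by simpa using h.bil_transpose_y_dy 1
  have h₂ : (fun β => bil 1 y dy * d β) = (fun β => bil 1 dy y * d β) - (2 : ℂ) • d := by
    simp only [h₁, sub_mul, smul_mul_assoc, one_mul]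
    rfl
  rw [h₂, bil_sub_right, bil_smul_right, h.bil_dy_bil_dy_y_mul, one_mul]
  module

lemma sum_bil_pauli_y_mul (h : IsWeyl dx y dy) :
    ∑ k, bil (pauli k) dy y * bil (pauli k) dy dx =
      bil 1 dy y * bil 1 dy dx - (2 : ℂ) • bil 1 dy dx := by
  rw [sum_bil_pauli_mul_bil_pauli, h.bil_dy_one_mul]
  module

lemma bil_pauli_dx_mul_sub (h : IsWeyl dx y dy) (x : Fin 2 → A) (i : Fin 3) :
    Complex.I • (bil (pauli (i + 1)) x dx * bil (pauli (i + 2)) dy dx -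
        bil (pauli (i + 2)) x dx * bil (pauli (i + 1)) dy dx) =
      bil 1 x dx * bil (pauli i) dy dx - bil (pauli i) x dx * bil 1 dy dx := by
  have h₁ : bil 1 dx dy = bil 1 dy dx := by simpa using h.bil_transpose_dx_dy 1
  rw [bil_pauli_mul_bil_pauli_sub, h₁, h.bil_transpose_dx_dy, bil_mul_of_commute (h.commute_dx _),
    bil_mul_of_commute (h.commute_dx _)]

lemma bil_pauli_y_mul_sub (h : IsWeyl dx y dy) (i : Fin 3) :
    Complex.I • (bil (pauli (i + 1)) dy y * bil (pauli (i + 2)) dy dx -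
        bil (pauli (i + 2)) dy y * bil (pauli (i + 1)) dy dx) =
      bil (pauli i) dy y * bil 1 dy dx - bil 1 dy y * bil (pauli i) dy dx +
        (2 : ℂ) • bil (pauli i) dy dx := by
  have htr : (pauli i).trace = 0 := by fin_cases i <;> simp [pauli]
  have h₁ : bil (pauli i).transpose y dy = bil (pauli i) dy y := by
    rw [h.bil_transpose_y_dy, htr, zero_smul, sub_zero]
  rw [bil_pauli_mul_bil_pauli_sub, h₁, h.bil_dy_bil_dy_y_mul, h.bil_dy_one_mul, mul_one]
  module

lemma sum_rotation_mul_momentum (h : IsWeyl dx y dy) (x : Fin 2 → A) :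
    ∑ k, (bil (pauli k) x dx - bil (pauli k) dy y) * bil (pauli k) dy dx =
      (bil 1 x dx - bil 1 dy y + (2 : ℂ) • 1) * bil 1 dy dx := by
  simp only [sub_mul, add_mul, Finset.sum_sub_distrib, h.sum_bil_pauli_dx_mul,
    h.sum_bil_pauli_y_mul, smul_one_mul]
  abel

lemma boost_mul_momentum_sub (h : IsWeyl dx y dy) (x : Fin 2 → A) (i : Fin 3) :
    Complex.I •
        ((bil (pauli (i + 1)) x dx + bil (pauli (i + 1)) dy y + bil (pauli (i + 1)) dy dx) *
            bil (pauli (i + 2)) dy dx -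
          (bil (pauli (i + 2)) x dx + bil (pauli (i + 2)) dy y + bil (pauli (i + 2)) dy dx) *
            bil (pauli (i + 1)) dy dx) =
      (bil 1 x dx - bil 1 dy y + (2 : ℂ) • 1) * bil (pauli i) dy dx -
        (bil (pauli i) x dx - bil (pauli i) dy y) * bil 1 dy dx := by
  have hx := h.bil_pauli_dx_mul_sub x i
  have hy := h.bil_pauli_y_mul_sub i
  have hcomm := (h.commute_bil (pauli (i + 1)) (pauli (i + 2))).eq
  simp only [add_mul, sub_mul, smul_one_mul, hcomm]
  linear_combination (norm := module) hx + hy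

end IsWeyl

/-! ### The Pauli–Lubanski vector of a massless field -/

/-- Both sides are determinants: multiply the matrix of the Levi-Civita symbol by the Vandermonde
matrix of `0, 1, 2, 3`, whose determinant is `12`. -/
lemma levi_eq (μ ν ρ σ : Fin 4) : levi μ ν ρ σ =
    ((((ν : ℕ) - (μ : ℕ)) * ((ρ : ℕ) - (μ : ℕ)) * ((σ : ℕ) - (μ : ℕ)) * ((ρ : ℕ) - (ν : ℕ)) *
      ((σ : ℕ) - (ν : ℕ)) * ((σ : ℕ) - (ρ : ℕ)) : ℤ) : ℂ) / 12 := by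
  have h₁₂ : (Matrix.vandermonde fun i : Fin 4 => ((i : ℕ) : ℂ)).det = 12 := by
    rw [Matrix.det_vandermonde]
    simp [Fin.prod_univ_succ, Fin.prod_Ioi_succ]
    norm_num
  have hmul : (Matrix.of fun i j : Fin 4 => if ![μ, ν, ρ, σ] i = j then (1 : ℂ) else 0) *
      (Matrix.vandermonde fun i : Fin 4 => ((i : ℕ) : ℂ)) =
      Matrix.vandermonde fun i => ((![μ, ν, ρ, σ] i : ℕ) : ℂ) := by
    ext i j
    simp [Matrix.mul_apply, Matrix.vandermonde_apply]
  rw [eq_div_iff (by norm_num), levi, ← h₁₂, ← Matrix.det_mul, hmul, Matrix.det_vandermonde]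
  simp [Fin.prod_univ_succ, Fin.prod_Ioi_succ]
  ring

section LeviCivita

variable {A : Type*} [Ring A] [Algebra ℂ A] {S : Fin 4 → Fin 4 → A}

lemma sum_levi_zero_smul (hS : ∀ μ ν, S μ ν = -S ν μ) (P : Fin 4 → A) :
    (1 / 2 : ℂ) • ∑ ν, ∑ ρ, ∑ σ, (levi 0 ν ρ σ * eta ν * eta ρ * eta σ) • (S ν ρ * P σ) =
      -∑ i : Fin 3, S (i + 1).succ (i + 2).succ * P i.succ := by
  have hsum : ∑ i : Fin 3, S (i + 1).succ (i + 2).succ * P i.succ =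
      S 2 3 * P 1 + S 3 1 * P 2 + S 1 2 * P 3 := Fin.sum_univ_three _
  rw [hsum]
  simp only [Fin.sum_univ_four, levi_eq, eta]
  simp [hS 3 2, hS 1 3, hS 2 1]
  norm_num
  module

lemma sum_levi_succ_smul (hS : ∀ μ ν, S μ ν = -S ν μ) (P : Fin 4 → A) (i : Fin 3) :
    (1 / 2 : ℂ) • ∑ ν, ∑ ρ, ∑ σ, (levi i.succ ν ρ σ * eta ν * eta ρ * eta σ) • (S ν ρ * P σ) =
      S 0 (i + 2).succ * P (i + 1).succ - S 0 (i + 1).succ * P (i + 2).succ -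
        S (i + 1).succ (i + 2).succ * P 0 := by
  fin_cases i <;>
  · simp only [Fin.sum_univ_four, levi_eq, eta]
    simp [hS 3 2, hS 1 3, hS 2 1, hS 1 0, hS 2 0, hS 3 0]
    norm_num
    module

end LeviCivita

lemma eta_succ (i : Fin 3) : eta i.succ = -1 := by
  fin_cases i <;> rfl

lemma gam_zero : gam 0 = Matrix.fromBlocks 1 0 0 (-1) := by
  simp [gam, eta, gammaUp]

lemma gam_succ (i : Fin 3) : gam i.succ = Matrix.fromBlocks 0 (-pauli i) (pauli i) 0 := by
  simp [gam, gammaUp, eta_succ, Matrix.fromBlocks_neg]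

lemma pauli_mul_pauli_mul_pauli : pauli 0 * pauli 1 * pauli 2 = Complex.I • 1 := by
  ext i j
  fin_cases i <;> fin_cases j <;> simp [pauli, Matrix.mul_apply]

lemma pauli_commutator (i : Fin 3) :
    pauli (i + 1) * pauli (i + 2) - pauli (i + 2) * pauli (i + 1) = (2 * Complex.I) • pauli i := by
  fin_cases i <;> ext j k <;> fin_cases j <;> fin_cases k <;> simp [pauli] <;> ring_nf <;> simp

lemma gam5_eq : gam5 = Matrix.fromBlocks 0 (-1) (-1) 0 := by
  have h₀ : gammaUp 0 = Matrix.fromBlocks 1 0 0 (-1) := rfl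
  have h₁ : gammaUp 1 = Matrix.fromBlocks 0 (pauli 0) (-pauli 0) 0 := rfl
  have h₂ : gammaUp 2 = Matrix.fromBlocks 0 (pauli 1) (-pauli 1) 0 := rfl
  have h₃ : gammaUp 3 = Matrix.fromBlocks 0 (pauli 2) (-pauli 2) 0 := rfl
  simp [gam5, h₀, h₁, h₂, h₃, Matrix.fromBlocks_multiply, pauli_mul_pauli_mul_pauli,
    Matrix.fromBlocks_smul, smul_smul, Matrix.fromBlocks_neg]

lemma genP_zero : genP 0 = (-(Complex.I / 2)) • Matrix.fromBlocks 1 (-1) 1 (-1) := by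
  rw [genP, genS5, genS4, gam5_eq, gam_zero]
  simp [Matrix.fromBlocks_multiply, Matrix.fromBlocks_smul, Matrix.fromBlocks_add,
    Matrix.fromBlocks_neg]

lemma genP_succ (i : Fin 3) : genP i.succ =
    (-(Complex.I / 2)) • Matrix.fromBlocks (pauli i) (-pauli i) (pauli i) (-pauli i) := by
  rw [genP, genS5, genS4, gam5_eq, gam_succ]
  simp [Matrix.fromBlocks_multiply, Matrix.fromBlocks_smul, Matrix.fromBlocks_add,
    Matrix.fromBlocks_neg]

lemma genS_antisymm (μ ν : Fin 4) : genS μ ν = -genS ν μ := by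
  rw [genS, genS, ← smul_neg, neg_sub]

lemma genS_zero_succ (i : Fin 3) : genS 0 i.succ =
    (1 / 2 : ℂ) • Matrix.fromBlocks 0 (pauli i) (pauli i) 0 := by
  rw [genS, gam_zero, gam_succ]
  simp [Matrix.fromBlocks_multiply, Matrix.fromBlocks_smul, sub_eq_add_neg, Matrix.fromBlocks_add,
    Matrix.fromBlocks_neg]
  module

lemma genS_succ_succ (i : Fin 3) : genS (i + 1).succ (i + 2).succ =
    (Complex.I / 2) • Matrix.fromBlocks (pauli i) 0 0 (pauli i) := by
  have hcomm : gam (i + 1).succ * gam (i + 2).succ - gam (i + 2).succ * gam (i + 1).succ =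
      (-(2 * Complex.I)) • Matrix.fromBlocks (pauli i) 0 0 (pauli i) := by
    rw [neg_smul, Matrix.fromBlocks_smul, ← pauli_commutator, gam_succ, gam_succ]
    simp [Matrix.fromBlocks_multiply, sub_eq_add_neg, Matrix.fromBlocks_add,
      Matrix.fromBlocks_neg, add_comm]
  rw [genS, hcomm, smul_smul]
  congr 1
  ring

lemma oscRep_fromBlocks {A : Type*} [Ring A] [Algebra ℂ A] (u v : Fin 2 ⊕ Fin 2 → A)
    (X Y Z W : Matrix (Fin 2) (Fin 2) ℂ) :
    oscRep u v (Matrix.fromBlocks X Y Z W) =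
      bil X (u ∘ Sum.inl) (v ∘ Sum.inl) + bil Y (u ∘ Sum.inl) (v ∘ Sum.inr) -
        (bil Z (u ∘ Sum.inr) (v ∘ Sum.inl) + bil W (u ∘ Sum.inr) (v ∘ Sum.inr)) := by
  simp only [oscRep_apply, bil, Gam, Matrix.fromBlocks_multiply, Fintype.sum_sum_type,
    Matrix.fromBlocks_apply₁₁, Matrix.fromBlocks_apply₁₂, Matrix.fromBlocks_apply₂₁,
    Matrix.fromBlocks_apply₂₂, one_mul, zero_mul, add_zero, zero_add, neg_mul, Matrix.neg_apply,
    Finset.sum_add_distrib, Function.comp_apply, neg_smul, Finset.sum_neg_distrib]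
  abel

namespace IsOscillator

section Ring

variable {A : Type*} [Ring A] [Algebra ℂ A] {u v : Fin 2 ⊕ Fin 2 → A}

lemma isWeyl (h : IsOscillator u v) :
    IsWeyl (v ∘ Sum.inl - v ∘ Sum.inr) (v ∘ Sum.inr) (u ∘ Sum.inr - u ∘ Sum.inl) where
  dx_dx α β := .sub_left (.sub_right (h.v_comm _ _) (h.v_comm _ _))
    (.sub_right (h.v_comm _ _) (h.v_comm _ _))
  dy_dy α β := .sub_left (.sub_right (h.u_comm _ _) (h.u_comm _ _))
    (.sub_right (h.u_comm _ _) (h.u_comm _ _))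
  dx_dy α β := by
    simp only [commute_iff_eq, Pi.sub_apply, Function.comp_apply, sub_mul, mul_sub, h.v_mul_u]
    simp [Gam]
    abel
  dy_y α β := by
    simp only [Pi.sub_apply, Function.comp_apply, sub_mul, mul_sub, h.v_mul_u]
    simp [Gam, Matrix.one_apply, eq_comm (a := β)]
    abel

lemma bil_sub_bil (u v : Fin 2 ⊕ Fin 2 → A) :
    bil 1 (u ∘ Sum.inl) (v ∘ Sum.inl - v ∘ Sum.inr) -
      bil 1 (u ∘ Sum.inr - u ∘ Sum.inl) (v ∘ Sum.inr) = oscRep u v 1 := by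
  rw [← Matrix.fromBlocks_one, oscRep_fromBlocks, bil_sub_right, bil_sub_left, bil_zero, bil_zero]
  abel

variable (u v)

lemma oscRep_momentum (τ : Matrix (Fin 2) (Fin 2) ℂ) :
    oscRep u v ((-(Complex.I / 2)) • Matrix.fromBlocks τ (-τ) τ (-τ)) =
      (Complex.I / 2) • bil τ (u ∘ Sum.inr - u ∘ Sum.inl) (v ∘ Sum.inl - v ∘ Sum.inr) := by
  simp only [map_smul, oscRep_fromBlocks, bil_sub_left, bil_sub_right, bil_neg]
  module

lemma oscRep_boost (i : Fin 3) : oscRep u v (genS 0 i.succ) =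
    (-(1 / 2) : ℂ) • (bil (pauli i) (u ∘ Sum.inl) (v ∘ Sum.inl - v ∘ Sum.inr) +
      bil (pauli i) (u ∘ Sum.inr - u ∘ Sum.inl) (v ∘ Sum.inr) +
      bil (pauli i) (u ∘ Sum.inr - u ∘ Sum.inl) (v ∘ Sum.inl - v ∘ Sum.inr)) := by
  rw [genS_zero_succ]
  simp only [map_smul, oscRep_fromBlocks, bil_sub_left, bil_sub_right, bil_zero]
  module

lemma oscRep_rotation (i : Fin 3) : oscRep u v (genS (i + 1).succ (i + 2).succ) =
    (Complex.I / 2) • (bil (pauli i) (u ∘ Sum.inl) (v ∘ Sum.inl - v ∘ Sum.inr) -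
      bil (pauli i) (u ∘ Sum.inr - u ∘ Sum.inl) (v ∘ Sum.inr)) := by
  rw [genS_succ_succ]
  simp only [map_smul, oscRep_fromBlocks, bil_sub_left, bil_sub_right, bil_zero]
  module

end Ring

variable {u v : Fin 2 ⊕ Fin 2 → Module.End ℂ Fuzzy}

theorem massSq_oscRep (h : IsOscillator u v) : massSq (oscRep u v) = 0 := by
  have hnull := h.isWeyl.sum_bil_pauli_dx_mul (u ∘ Sum.inr - u ∘ Sum.inl)
  simp only [massSq, Fin.sum_univ_succ (n := 3), genP_zero, genP_succ, oscRep_momentum,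
    eta_succ, smul_mul_smul_comm, neg_one_smul, ← Finset.smul_sum, hnull]
  simp [eta]

lemma pauliLub_oscRep_zero (h : IsOscillator u v) : pauliLub (oscRep u v) 0 =
    (-(Complex.I / 2)) • ((oscRep u v 1 + (2 : ℂ) • 1) * oscRep u v (genP 0)) := by
  rw [pauliLub, sum_levi_zero_smul (S := fun μ ν => oscRep u v (genS μ ν))
    (fun μ ν => by rw [genS_antisymm, map_neg]) (fun μ => oscRep u v (genP μ)), ← bil_sub_bil]
  simp only [genP_zero, genP_succ, oscRep_momentum, oscRep_rotation, smul_mul_assoc,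
    mul_smul_comm, ← Finset.smul_sum, h.isWeyl.sum_rotation_mul_momentum]
  module

lemma pauliLub_oscRep_succ (h : IsOscillator u v) (i : Fin 3) : pauliLub (oscRep u v) i.succ =
    (-(Complex.I / 2)) • ((oscRep u v 1 + (2 : ℂ) • 1) * oscRep u v (genP i.succ)) := by
  have hboost := h.isWeyl.boost_mul_momentum_sub (u ∘ Sum.inl) i
  rw [pauliLub, sum_levi_succ_smul (S := fun μ ν => oscRep u v (genS μ ν))
    (fun μ ν => by rw [genS_antisymm, map_neg]) (fun μ => oscRep u v (genP μ)), ← bil_sub_bil]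
  simp only [genP_zero, genP_succ, oscRep_momentum, oscRep_rotation, oscRep_boost,
    smul_mul_assoc, mul_smul_comm]
  rw [← eq_sub_iff_add_eq.mp hboost]
  match_scalars <;> grind [Complex.I_sq]

theorem pauliLub_oscRep (h : IsOscillator u v) (μ : Fin 4) : pauliLub (oscRep u v) μ =
    (-(Complex.I / 2)) • ((oscRep u v 1 + (2 : ℂ) • 1) * oscRep u v (genP μ)) :=
  Fin.cases h.pauliLub_oscRep_zero h.pauliLub_oscRep_succ μ

end IsOscillator

/-! ### The complexification of `su(2,2)` -/

lemma Gam_conjTranspose : Gam.conjTranspose = Gam := by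
  simp [Gam, Matrix.fromBlocks_conjTranspose]

lemma Gam_transpose : Gam.transpose = Gam := by
  simp [Gam, Matrix.fromBlocks_transpose]

lemma mem_su22_iff {X : Mat} : X ∈ su22 ↔ Gam * X.conjTranspose * Gam = -X ∧ X.trace = 0 := by
  refine and_congr_left fun _ => ⟨fun h => ?_, fun h => ?_⟩
  · rw [mul_assoc, eq_neg_of_add_eq_zero_left h, mul_neg, ← mul_assoc, Gam_mul_Gam, one_mul]
  · have hGX : Gam * -X = X.conjTranspose * Gam := by
      rw [← h, ← mul_assoc, ← mul_assoc, Gam_mul_Gam, one_mul]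
    rw [← hGX, mul_neg, neg_add_cancel]

lemma exists_su22_add_smul {X : Mat} (hX : X.trace = 0) :
    ∃ Y ∈ su22, ∃ Z ∈ su22, X = Y + Complex.I • Z := by
  set X' := Gam * X.conjTranspose * Gam with hX'
  have hinv : Gam * X'.conjTranspose * Gam = X := by
    simp only [hX', Matrix.conjTranspose_mul, Matrix.conjTranspose_conjTranspose,
      Gam_conjTranspose, ← mul_assoc, Gam_mul_Gam, one_mul]
    rw [mul_assoc, Gam_mul_Gam, mul_one]
  have htr : X'.trace = 0 := by
    rw [hX', Matrix.trace_mul_comm, ← mul_assoc, Gam_mul_Gam, one_mul,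
      Matrix.trace_conjTranspose, hX, star_zero]
  refine ⟨(1 / 2 : ℂ) • (X - X'), mem_su22_iff.2 ⟨?_, by simp [hX, htr]⟩,
    (-Complex.I / 2 : ℂ) • (X + X'), mem_su22_iff.2 ⟨?_, by simp [hX, htr]⟩, ?_⟩
  · simp [mul_sub, sub_mul, hinv, ← hX']
    module
  · simp [mul_add, add_mul, hinv, ← hX']
    module
  · match_scalars <;> grind [Complex.I_sq]

lemma neg_transpose_mem_su22 {X : Mat} (hX : X ∈ su22) : -X.transpose ∈ su22 := by
  obtain ⟨hX, htr⟩ := mem_su22_iff.1 hX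
  have hconj : X.transpose.conjTranspose = X.conjTranspose.transpose := rfl
  refine mem_su22_iff.2 ⟨?_, by simp [htr]⟩
  rw [Matrix.conjTranspose_neg, hconj, mul_neg, neg_mul, neg_inj, ← Matrix.transpose_neg, ← hX,
    Matrix.transpose_mul, Matrix.transpose_mul, Gam_transpose, mul_assoc]

lemma IsInvariant.apply_mem_of_trace_eq_zero {R : Mat →ₗ[ℂ] Module.End ℂ Fuzzy}
    {U : Submodule ℂ Fuzzy} (hU : IsInvariant R su22 U) {X : Mat} (hX : X.trace = 0) {Ψ : Fuzzy}
    (hΨ : Ψ ∈ U) : R X Ψ ∈ U := by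
  obtain ⟨Y, hY, Z, hZ, rfl⟩ := exists_su22_add_smul hX
  rw [map_add, map_smul]
  exact U.add_mem (hU Y hY Ψ hΨ) (U.smul_mem _ (hU Z hZ Ψ hΨ))

/-! ### The oscillator representations on fuzzy functions of fixed chirality -/

lemma isOscillator_osc : IsOscillator oscAdag oscA where
  u_comm i j := by
    refine LinearMap.ext fun Ψ => ?_
    rcases i with α | α <;> rcases j with β | β <;>
      simp only [oscAdag, Sum.elim_inl, Sum.elim_inr, Module.End.mul_apply,
        LinearMap.mulLeft_apply, LinearMap.mulRight_apply, mul_assoc]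
    · rw [← mul_assoc, cre_mul_comm, mul_assoc]
    · rw [cre_mul_comm]
  v_comm i j := by
    refine LinearMap.ext fun Ψ => ?_
    rcases i with α | α <;> rcases j with β | β <;>
      simp only [oscA, Sum.elim_inl, Sum.elim_inr, Module.End.mul_apply,
        LinearMap.mulLeft_apply, LinearMap.mulRight_apply, mul_assoc]
    · rw [← mul_assoc, ann_mul_comm, mul_assoc]
    · rw [ann_mul_comm]
  v_mul_u i j := by
    refine LinearMap.ext fun Ψ => ?_
    rcases i with α | α <;> rcases j with β | β <;>
      simp only [oscA, oscAdag, Sum.elim_inl, Sum.elim_inr, Module.End.mul_apply,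
        LinearMap.mulLeft_apply, LinearMap.mulRight_apply, mul_assoc, LinearMap.add_apply,
        LinearMap.smul_apply, Module.End.one_apply, Gam, Matrix.fromBlocks_apply₁₁,
        Matrix.fromBlocks_apply₁₂, Matrix.fromBlocks_apply₂₁, Matrix.fromBlocks_apply₂₂,
        Matrix.zero_apply, zero_smul, add_zero]
    · rw [← mul_assoc, ann_mul_cre, add_mul, mul_assoc, smul_mul_assoc, one_mul]
    · rw [ann_mul_cre, mul_add, mul_smul_comm, mul_one, Matrix.neg_apply, neg_smul,
        add_neg_cancel_right]

lemma fundRep_eq_oscRep : fundRep = oscRep oscAdag oscA :=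
  funext fun X => (oscRep_apply _ _ X).symm

lemma dualRep_eq_oscRep {X : Mat} (hX : X.trace = 0) :
    dualRep X = oscRep (fun i => -(Gam i i • oscA i)) (fun i => Gam i i • oscAdag i) X := by
  rw [isOscillator_osc.oscRep_canonical, hX, zero_smul, sub_zero, dualRep, fundRep_eq_oscRep]

lemma bil_one_inl :
    bil 1 (oscAdag ∘ Sum.inl) (oscA ∘ Sum.inl) = LinearMap.mulLeft ℂ numOp := by
  ext Ψ : 1
  simp [bil_one, oscA, oscAdag, numOp, add_mul, mul_assoc]

lemma bil_one_inr :
    bil 1 (oscAdag ∘ Sum.inr) (oscA ∘ Sum.inr) = LinearMap.mulRight ℂ numOp + (2 : ℂ) • 1 := by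
  ext Ψ : 1
  simp only [bil_one, oscA, oscAdag, numOp, Fin.sum_univ_two, Function.comp_apply, Sum.elim_inr,
    LinearMap.add_apply, Module.End.mul_apply, LinearMap.mulRight_apply, mul_assoc, ann_mul_cre,
    Matrix.one_apply_eq, mul_add, one_smul, mul_one, LinearMap.smul_apply, Module.End.one_apply]
  module

lemma fundRep_one :
    fundRep 1 = LinearMap.mulLeft ℂ numOp - LinearMap.mulRight ℂ numOp - (2 : ℂ) • 1 := by
  rw [fundRep_eq_oscRep, ← Matrix.fromBlocks_one, oscRep_fromBlocks, bil_one_inl, bil_one_inr,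
    bil_zero, bil_zero]
  abel

lemma fundRep_one_apply_of_mem_grade {κ : ℂ} {Ψ : Fuzzy} (hΨ : Ψ ∈ grade κ) :
    fundRep 1 Ψ = (κ - 2) • Ψ := by
  rw [fundRep_one, LinearMap.sub_apply, LinearMap.sub_apply, LinearMap.mulLeft_apply,
    LinearMap.mulRight_apply, mem_grade.1 hΨ, LinearMap.smul_apply, Module.End.one_apply]
  module

lemma energy_fundRep_apply (Ψ : Fuzzy) :
    energy fundRep Ψ = (1 / 2 : ℂ) • (numOp * Ψ + Ψ * numOp + (2 : ℂ) • Ψ) := by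
  have hS : genS5 0 = (-(Complex.I / 2)) • Matrix.fromBlocks 1 0 0 (-1) := by
    rw [genS5, gam_zero]
  rw [energy, fundRep_eq_oscRep, hS, map_smul, oscRep_fromBlocks, bil_neg, bil_one_inl,
    bil_one_inr, bil_zero, bil_zero, smul_smul]
  have hI : Complex.I * -(Complex.I / 2) = 1 / 2 := by grind [Complex.I_sq]
  rw [hI]
  simp
  module

lemma oscAdag_mul_oscA_mem_grade {κ : ℂ} {Ψ : Fuzzy} (hΨ : Ψ ∈ grade κ) (i j : Fin 2 ⊕ Fin 2) :
    (oscAdag i * oscA j) Ψ ∈ grade κ := by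
  have lower : oscA j Ψ ∈ grade (κ - 1) := by
    rcases j with α | α
    · simpa [oscA, sub_eq_neg_add] using mul_mem_grade (ann_mem_grade α) hΨ
    · simpa [oscA, sub_eq_add_neg] using mul_mem_grade hΨ (ann_mem_grade α)
  rcases i with α | α
  · simpa [oscAdag] using mul_mem_grade (cre_mem_grade α) lower
  · simpa [oscAdag] using mul_mem_grade lower (cre_mem_grade α)

lemma fundRep_apply_mem {V : Submodule ℂ Fuzzy} {Ψ : Fuzzy}
    (h : ∀ i j, (oscAdag i * oscA j) Ψ ∈ V) (X : Mat) : fundRep X Ψ ∈ V := by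
  rw [fundRep_eq_oscRep]
  exact oscRep_mem (V := V.comap (LinearMap.applyₗ Ψ)) h X

lemma fundRep_mem_grade {κ : ℂ} {Ψ : Fuzzy} (hΨ : Ψ ∈ grade κ) (X : Mat) :
    fundRep X Ψ ∈ grade κ :=
  fundRep_apply_mem (oscAdag_mul_oscA_mem_grade hΨ) X

lemma IsInvariant.oscAdag_mul_oscA_mem {κ : ℂ} {U : Submodule ℂ Fuzzy} (hle : U ≤ grade κ)
    (hU : IsInvariant fundRep su22 U) {Ψ : Fuzzy} (hΨ : Ψ ∈ U) (i j : Fin 2 ⊕ Fin 2) :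
    (oscAdag i * oscA j) Ψ ∈ U := by
  set X := Gam * Matrix.single i j 1 with hX
  have split : X = (X - (X.trace / 4) • 1) + (X.trace / 4) • 1 := (sub_add_cancel _ _).symm
  have htr : (X - (X.trace / 4) • 1).trace = 0 := by
    simp
  rw [← oscRep_Gam_mul_single, ← hX, split, map_add, map_smul, ← fundRep_eq_oscRep,
    LinearMap.add_apply, LinearMap.smul_apply, fundRep_one_apply_of_mem_grade (hle hΨ)]
  rw [fundRep_eq_oscRep] at hU ⊢
  exact U.add_mem (hU.apply_mem_of_trace_eq_zero htr hΨ) (U.smul_mem _ (U.smul_mem _ hΨ))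

/-! ### Helicity -/

lemma trace_genP (μ : Fin 4) : (genP μ).trace = 0 := by
  refine Fin.cases ?_ (fun i => ?_) μ
  · simp [genP_zero, Matrix.trace]
  · simp [genP_succ, Matrix.trace]

lemma trace_genS (μ ν : Fin 4) : (genS μ ν).trace = 0 := by
  rw [genS, Matrix.trace_smul, Matrix.trace_sub, Matrix.trace_mul_comm, sub_self, smul_zero]

section Congr

variable {R R' : Mat → Module.End ℂ Fuzzy} (h : ∀ X : Mat, X.trace = 0 → R X = R' X)
include h

lemma massSq_congr : massSq R = massSq R' := by
  simp only [massSq, h _ (trace_genP _)]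

lemma pauliLub_congr (μ : Fin 4) : pauliLub R μ = pauliLub R' μ := by
  simp only [pauliLub, h _ (trace_genP _), h _ (trace_genS _ _)]

lemma hasHelicity_congr {V : Submodule ℂ Fuzzy} {c : ℝ} :
    HasHelicity R V c ↔ HasHelicity R' V c := by
  simp only [HasHelicity, pauliLub_congr h, h _ (trace_genP _)]

end Congr

lemma HasHelicity.pauliLubSq_apply {R : Mat → Module.End ℂ Fuzzy} {V : Submodule ℂ Fuzzy} {h : ℝ}
    (hV : HasHelicity R V h) (hP : ∀ μ, ∀ Ψ ∈ V, R (genP μ) Ψ ∈ V) {Ψ : Fuzzy} (hΨ : Ψ ∈ V) :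
    pauliLubSq R Ψ = (-(h : ℂ) ^ 2) • massSq R Ψ := by
  have hW (μ : Fin 4) {Φ : Fuzzy} (hΦ : Φ ∈ V) :
      pauliLub R μ Φ = -((h : ℂ) • Complex.I • R (genP μ) Φ) := by
    rw [← hV μ Φ hΦ, neg_neg]
  rw [pauliLubSq, massSq, LinearMap.sum_apply, LinearMap.sum_apply, Finset.smul_sum]
  refine Finset.sum_congr rfl fun μ _ => ?_
  simp only [LinearMap.smul_apply, Module.End.mul_apply, hW μ hΨ, map_neg, map_smul,
    hW μ (hP μ Ψ hΨ)]
  match_scalars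
  grind [Complex.I_sq]

lemma IsOscillator.hasHelicity {u v : Fin 2 ⊕ Fin 2 → Module.End ℂ Fuzzy} (huv : IsOscillator u v)
    {V : Submodule ℂ Fuzzy} {h : ℝ} (hN : ∀ Ψ ∈ V, oscRep u v 1 Ψ = (2 * h - 2 : ℂ) • Ψ)
    (hP : ∀ μ, ∀ Ψ ∈ V, oscRep u v (genP μ) Ψ ∈ V) : HasHelicity (oscRep u v) V h := by
  intro μ Ψ hΨ
  rw [huv.pauliLub_oscRep, LinearMap.smul_apply, Module.End.mul_apply, LinearMap.add_apply,
    hN _ (hP μ Ψ hΨ), LinearMap.smul_apply, Module.End.one_apply]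
  module

lemma massSq_fundRep : massSq fundRep = 0 := by
  rw [fundRep_eq_oscRep, isOscillator_osc.massSq_oscRep]

lemma massSq_dualRep : massSq dualRep = 0 := by
  rw [massSq_congr fun X => dualRep_eq_oscRep, isOscillator_osc.canonical.massSq_oscRep]

lemma hasHelicity_fundRep (κ : ℝ) : HasHelicity fundRep (grade κ) (κ / 2) := by
  rw [fundRep_eq_oscRep]
  refine isOscillator_osc.hasHelicity (fun Ψ hΨ => ?_) fun μ Ψ hΨ => ?_ <;>
    rw [← fundRep_eq_oscRep]
  · rw [fundRep_one_apply_of_mem_grade hΨ]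
    push_cast
    congr 1
    ring
  · exact fundRep_mem_grade hΨ _

lemma hasHelicity_dualRep (κ : ℝ) : HasHelicity dualRep (grade κ) (-(κ / 2)) := by
  rw [hasHelicity_congr fun X => dualRep_eq_oscRep]
  refine isOscillator_osc.canonical.hasHelicity (fun Ψ hΨ => ?_) fun μ Ψ hΨ => ?_
  · rw [isOscillator_osc.oscRep_canonical, Matrix.transpose_one, map_neg, ← fundRep_eq_oscRep,
      LinearMap.sub_apply, LinearMap.neg_apply, fundRep_one_apply_of_mem_grade hΨ,
      LinearMap.smul_apply, Module.End.one_apply]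
    simp
    module
  · rw [← dualRep_eq_oscRep (trace_genP μ)]
    exact fundRep_mem_grade hΨ _

/-! ### The Hilbert–Schmidt product -/

/-- The span of the rank one operators `(a†)ᵖ|0⟩⟨0|a^q`, on which the Hilbert–Schmidt product is a
finite sum. -/
def rankOneSpan : Submodule ℂ Fuzzy :=
  Submodule.span ℂ (Set.range fun r : Occ × Occ => rankOne r.1 r.2)

lemma rankOne_mem_rankOneSpan (p q : Occ) : rankOne p q ∈ rankOneSpan :=
  Submodule.subset_span ⟨(p, q), rfl⟩

lemma ladderSpan_rankOne_le_rankOneSpan (κ : ℤ) : ladderSpan ℂ rankOne κ ≤ rankOneSpan :=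
  ladderSpan_le.2 fun p q _ => rankOne_mem_rankOneSpan p q

lemma matElem_add (Ψ Φ : Fuzzy) (m n : Occ) :
    matElem (Ψ + Φ) m n = matElem Ψ m n + matElem Φ m n := by
  simp [matElem]

lemma matElem_smul (c : ℂ) (Ψ : Fuzzy) (m n : Occ) :
    matElem (c • Ψ) m n = c * matElem Ψ m n := by
  simp [matElem]

lemma mbra_apply_mket (Φ : Fuzzy) (p q : Occ) : mbra p (Φ (mket q)) =
    ((√(occFact p : ℝ) : ℝ) : ℂ) * ((√(occFact q : ℝ) : ℝ) : ℂ) * matElem Φ p q := by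
  simp [mbra, mket, matElem, mul_assoc]

lemma matElem_rankOne (p q m n : Occ) : matElem (rankOne p q) m n =
    if (m, n) = (p, q) then ((√(occFact p : ℝ) : ℝ) : ℂ) * ((√(occFact q : ℝ) : ℝ) : ℂ) else 0 := by
  simp only [matElem, rankOne_apply, mbra, mket, ket, LinearMap.smul_apply,
    Module.Basis.coord_apply, Module.Basis.repr_self, map_smul, Finsupp.smul_apply,
    Finsupp.single_apply, smul_eq_mul, Prod.mk.injEq]
  split_ifs <;> simp_all [mul_comm]

lemma finite_support_matElem {Ψ : Fuzzy} (hΨ : Ψ ∈ rankOneSpan) :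
    (Function.support fun r : Occ × Occ => matElem Ψ r.1 r.2).Finite := by
  induction hΨ using Submodule.span_induction with
  | mem Ψ h =>
    obtain ⟨⟨p, q⟩, rfl⟩ := h
    refine (Set.finite_singleton (p, q)).subset fun r hr => ?_
    rw [Function.mem_support, matElem_rankOne] at hr
    exact (ite_ne_right_iff.1 hr).1
  | zero => simp [matElem, Function.support]
  | add Ψ Φ _ _ hΨ hΦ =>
    simp only [matElem_add]
    exact (hΨ.union hΦ).subset (Function.support_add _ _)
  | smul c Ψ _ h =>
    simp only [matElem_smul]
    exact h.subset fun r hr => right_ne_zero_of_mul hr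

lemma isHS_of_mem_rankOneSpan {Ψ : Fuzzy} (hΨ : Ψ ∈ rankOneSpan) : IsHS Ψ :=
  summable_of_hasFiniteSupport ((finite_support_matElem hΨ).subset fun r hr h => hr (by simp [h]))

lemma summable_hsInner {Ψ : Fuzzy} (hΨ : Ψ ∈ rankOneSpan) (Φ : Fuzzy) :
    Summable fun r : Occ × Occ =>
      (starRingEnd ℂ) (matElem Ψ r.1 r.2) * matElem Φ r.1 r.2 :=
  summable_of_hasFiniteSupport ((finite_support_matElem hΨ).subset fun r hr h => hr (by simp [h]))

lemma hsInner_zero_left (Φ : Fuzzy) : hsInner 0 Φ = 0 := by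
  simp [hsInner, matElem]

lemma hsInner_zero_right (Ψ : Fuzzy) : hsInner Ψ 0 = 0 := by
  simp [hsInner, matElem]

lemma hsInner_add_left {Ψ Ψ' : Fuzzy} (hΨ : Ψ ∈ rankOneSpan) (hΨ' : Ψ' ∈ rankOneSpan)
    (Φ : Fuzzy) : hsInner (Ψ + Ψ') Φ = hsInner Ψ Φ + hsInner Ψ' Φ := by
  simp only [hsInner, ← (summable_hsInner hΨ Φ).tsum_add (summable_hsInner hΨ' Φ), matElem_add,
    map_add, add_mul]

lemma hsInner_add_right {Ψ : Fuzzy} (hΨ : Ψ ∈ rankOneSpan) (Φ Φ' : Fuzzy) :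
    hsInner Ψ (Φ + Φ') = hsInner Ψ Φ + hsInner Ψ Φ' := by
  simp only [hsInner, ← (summable_hsInner hΨ Φ).tsum_add (summable_hsInner hΨ Φ'), matElem_add,
    mul_add]

lemma hsInner_smul_left (c : ℂ) (Ψ Φ : Fuzzy) :
    hsInner (c • Ψ) Φ = (starRingEnd ℂ) c * hsInner Ψ Φ := by
  simp only [hsInner, ← tsum_mul_left, matElem_smul, map_mul, mul_assoc]

lemma hsInner_smul_right (c : ℂ) (Ψ Φ : Fuzzy) : hsInner Ψ (c • Φ) = c * hsInner Ψ Φ := by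
  simp only [hsInner, ← tsum_mul_left, matElem_smul, mul_left_comm]

lemma hsInner_rankOne (p q : Occ) (Φ : Fuzzy) :
    hsInner (rankOne p q) Φ = mbra p (Φ (mket q)) := by
  rw [hsInner, tsum_eq_single (p, q) fun r hr => by simp [matElem_rankOne, hr], mbra_apply_mket,
    matElem_rankOne, if_pos rfl]
  simp

/-- `T'` is a Hilbert–Schmidt adjoint of `T` on the span of the rank one operators. -/
structure IsHSAdjoint (T T' : Module.End ℂ Fuzzy) : Prop where
  map_mem {Ψ : Fuzzy} (hΨ : Ψ ∈ rankOneSpan) : T Ψ ∈ rankOneSpan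
  hsInner_map {Ψ : Fuzzy} (hΨ : Ψ ∈ rankOneSpan) (Φ : Fuzzy) :
    hsInner (T Ψ) Φ = hsInner Ψ (T' Φ)

namespace IsHSAdjoint

variable {S S' T T' : Module.End ℂ Fuzzy}

lemma of_rankOne (hmem : ∀ p q, T (rankOne p q) ∈ rankOneSpan)
    (h : ∀ p q Φ, hsInner (T (rankOne p q)) Φ = mbra p (T' Φ (mket q))) : IsHSAdjoint T T' := by
  have hle : rankOneSpan ≤ rankOneSpan.comap T :=
    Submodule.span_le.2 (Set.range_subset_iff.2 fun r => hmem r.1 r.2)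
  refine ⟨fun hΨ => hle hΨ, fun hΨ Φ => ?_⟩
  induction hΨ using Submodule.span_induction with
  | mem Ψ hΨ =>
    obtain ⟨⟨p, q⟩, rfl⟩ := hΨ
    rw [h, hsInner_rankOne]
  | zero => rw [map_zero, hsInner_zero_left, hsInner_zero_left]
  | add Ψ Ψ' hΨ hΨ' ih ih' =>
    rw [map_add, hsInner_add_left (hle hΨ) (hle hΨ'), hsInner_add_left hΨ hΨ', ih, ih']
  | smul c Ψ _ ih => rw [map_smul, hsInner_smul_left, hsInner_smul_left, ih]

lemma zero : IsHSAdjoint 0 0 where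
  map_mem _ := rankOneSpan.zero_mem
  hsInner_map _ _ := (hsInner_zero_left _).trans (hsInner_zero_right _).symm

lemma add (hS : IsHSAdjoint S S') (hT : IsHSAdjoint T T') : IsHSAdjoint (S + T) (S' + T') where
  map_mem hΨ := rankOneSpan.add_mem (hS.map_mem hΨ) (hT.map_mem hΨ)
  hsInner_map hΨ Φ := by
    rw [LinearMap.add_apply, LinearMap.add_apply, hsInner_add_left (hS.map_mem hΨ) (hT.map_mem hΨ),
      hsInner_add_right hΨ, hS.hsInner_map hΨ, hT.hsInner_map hΨ]

lemma sum {ι : Type*} (s : Finset ι) {T T' : ι → Module.End ℂ Fuzzy}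
    (h : ∀ i, IsHSAdjoint (T i) (T' i)) : IsHSAdjoint (∑ i ∈ s, T i) (∑ i ∈ s, T' i) := by
  classical
  induction s using Finset.induction_on with
  | empty => exact zero
  | insert i s hi ih => simpa only [Finset.sum_insert hi] using (h i).add ih

lemma smul (c : ℂ) (hT : IsHSAdjoint T T') : IsHSAdjoint (c • T) ((starRingEnd ℂ) c • T') where
  map_mem hΨ := rankOneSpan.smul_mem c (hT.map_mem hΨ)
  hsInner_map hΨ Φ := by
    rw [LinearMap.smul_apply, LinearMap.smul_apply, hsInner_smul_left, hsInner_smul_right,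
      hT.hsInner_map hΨ]

lemma mul (hS : IsHSAdjoint S S') (hT : IsHSAdjoint T T') : IsHSAdjoint (S * T) (T' * S') where
  map_mem hΨ := hS.map_mem (hT.map_mem hΨ)
  hsInner_map hΨ Φ := by
    rw [Module.End.mul_apply, Module.End.mul_apply, hS.hsInner_map (hT.map_mem hΨ),
      hT.hsInner_map hΨ]

end IsHSAdjoint

lemma isHSAdjoint_oscA (i : Fin 2 ⊕ Fin 2) : IsHSAdjoint (oscA i) (oscAdag i) := by
  rcases i with α | α
  · have lower (p q : Occ) :
        oscA (.inl α) (rankOne p q) = (p α : ℂ) • rankOne (p - Pi.single α 1) q :=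
      (isLadder_rankOne.fst q).lower α p
    refine .of_rankOne (fun p q => ?_) fun p q Φ => ?_
    · exact lower p q ▸ Submodule.smul_mem _ _ (rankOne_mem_rankOneSpan _ _)
    · simp [lower, hsInner_smul_left, hsInner_rankOne, oscAdag, mbra_cre]
  · have raise (p q : Occ) : oscA (.inr α) (rankOne p q) = rankOne p (q + Pi.single α 1) :=
      (isLadder_rankOne.snd p).raise α q
    refine .of_rankOne (fun p q => ?_) fun p q Φ => ?_
    · exact raise p q ▸ rankOne_mem_rankOneSpan _ _
    · simp [raise, hsInner_rankOne, oscAdag, cre_mket]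

lemma isHSAdjoint_oscAdag (i : Fin 2 ⊕ Fin 2) : IsHSAdjoint (oscAdag i) (oscA i) := by
  rcases i with α | α
  · have raise (p q : Occ) : oscAdag (.inl α) (rankOne p q) = rankOne (p + Pi.single α 1) q :=
      (isLadder_rankOne.fst q).raise α p
    refine .of_rankOne (fun p q => ?_) fun p q Φ => ?_
    · exact raise p q ▸ rankOne_mem_rankOneSpan _ _
    · simp [raise, hsInner_rankOne, oscA, mbra_ann]
  · have lower (p q : Occ) :
        oscAdag (.inr α) (rankOne p q) = (q α : ℂ) • rankOne p (q - Pi.single α 1) :=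
      (isLadder_rankOne.snd p).lower α q
    refine .of_rankOne (fun p q => ?_) fun p q Φ => ?_
    · exact lower p q ▸ Submodule.smul_mem _ _ (rankOne_mem_rankOneSpan _ _)
    · simp [lower, hsInner_smul_left, hsInner_rankOne, oscA, ann_mket]

lemma isHSAdjoint_fundRep (X : Mat) :
    IsHSAdjoint (fundRep X) (fundRep (Gam * X.conjTranspose * Gam)) := by
  have hstar (i j : Fin 2 ⊕ Fin 2) : (Gam * (Gam * X.conjTranspose * Gam)) j i =
      (starRingEnd ℂ) ((Gam * X) i j) := by
    rw [← mul_assoc, ← mul_assoc, Gam_mul_Gam, one_mul, ← Gam_conjTranspose,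
      ← Matrix.conjTranspose_mul, Matrix.conjTranspose_apply, Gam_conjTranspose]
    rfl
  rw [fundRep, fundRep, Finset.sum_comm (f := fun i j =>
    (Gam * (Gam * X.conjTranspose * Gam)) i j • (oscAdag i * oscA j))]
  simp only [hstar]
  exact .sum _ fun i => .sum _ fun j => ((isHSAdjoint_oscAdag i).mul (isHSAdjoint_oscA j)).smul _

lemma hsInner_fundRep {X : Mat} (hX : X ∈ su22) {Ψ : Fuzzy} (hΨ : Ψ ∈ rankOneSpan) (Φ : Fuzzy) :
    hsInner (fundRep X Ψ) Φ = -hsInner Ψ (fundRep X Φ) := by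
  rw [(isHSAdjoint_fundRep X).hsInner_map hΨ, (mem_su22_iff.1 hX).1, fundRep_eq_oscRep, map_neg,
    LinearMap.neg_apply, ← neg_one_smul ℂ, hsInner_smul_right, neg_one_mul]

/-! ### The conformal energy -/

lemma energy_fundRep_apply_of_mem_grade {κ : ℂ} {Ψ : Fuzzy} (hΨ : Ψ ∈ grade κ) :
    energy fundRep Ψ = Ψ * numOp + (1 + κ / 2) • Ψ := by
  rw [energy_fundRep_apply, mem_grade.1 hΨ]
  module

lemma energy_fundRep_apply_eq_smul_iff {κ E : ℂ} {Ψ : Fuzzy} (hΨ : Ψ ∈ grade κ) :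
    energy fundRep Ψ = E • Ψ ↔ Ψ * numOp = (E - (1 + κ / 2)) • Ψ := by
  rw [energy_fundRep_apply_of_mem_grade hΨ, sub_smul, eq_sub_iff_add_eq]

lemma rankOne_mem_grade {κ : ℤ} {p q : Occ} (h : (total p : ℤ) - total q = κ) :
    rankOne p q ∈ grade κ :=
  ladderSpan_rankOne_le_grade κ (mem_ladderSpan h)

lemma energy_fundRep_rankOne {κ : ℕ} {p q : Occ} (h : (total p : ℤ) - total q = κ) :
    energy fundRep (rankOne p q) = ((1 + (κ : ℝ) / 2 + total q : ℝ) : ℂ) • rankOne p q := by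
  rw [energy_fundRep_apply_eq_smul_iff (rankOne_mem_grade h), rankOne_mul_numOp]
  push_cast
  ring_nf

lemma ladderSpan_rankOne_le_sector (κ : ℤ) : ladderSpan ℂ rankOne κ ≤ sector κ :=
  sector_eq_grade κ ▸ ladderSpan_rankOne_le_grade κ

lemma exists_nat_of_mem_eigenvaluesOn {κ : ℕ} {E : ℂ}
    (hE : E ∈ eigenvaluesOn (energy fundRep) (sector κ)) :
    ∃ k : ℕ, E = ((1 + (κ : ℝ) / 2 + k : ℝ) : ℂ) := by
  obtain ⟨Ψ, hΨ, h0, hE⟩ := hE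
  rw [sector_eq_grade] at hΨ
  obtain ⟨k, hk⟩ := exists_nat_of_mul_numOp ((energy_fundRep_apply_eq_smul_iff hΨ).1 hE) h0
  refine ⟨k, ?_⟩
  push_cast at hk ⊢
  linear_combination hk

lemma mem_eigenvaluesOn_ladderSpan_rankOne (κ k : ℕ) :
    ((1 + (κ : ℝ) / 2 + k : ℝ) : ℂ) ∈
      eigenvaluesOn (energy fundRep) (ladderSpan ℂ rankOne κ) := by
  have h : (total (Pi.single 0 (κ + k) : Occ) : ℤ) - total (Pi.single 0 k : Occ) = κ := by
    simp [total_single]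
  refine ⟨_, mem_ladderSpan h, rankOne_ne_zero _ _, ?_⟩
  rw [energy_fundRep_rankOne h, total_single]

lemma eigenvaluesOn_mono (H : Module.End ℂ Fuzzy) : Monotone (eigenvaluesOn H) :=
  fun _ _ hle _ ⟨Ψ, hΨ, h⟩ => ⟨Ψ, hle hΨ, h⟩

theorem eigenvaluesOn_energy_ladderSpan_rankOne (κ : ℕ) :
    eigenvaluesOn (energy fundRep) (ladderSpan ℂ rankOne κ) =
      Set.range fun k : ℕ => ((1 + (κ : ℝ) / 2 + k : ℝ) : ℂ) := by
  refine subset_antisymm (fun E hE => ?_)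
    (Set.range_subset_iff.2 (mem_eigenvaluesOn_ladderSpan_rankOne κ))
  obtain ⟨k, rfl⟩ :=
    exists_nat_of_mem_eigenvaluesOn (eigenvaluesOn_mono _ (ladderSpan_rankOne_le_sector κ) hE)
  exact ⟨k, rfl⟩

theorem eigenvaluesOn_energy_sector (κ : ℕ) : eigenvaluesOn (energy fundRep) (sector κ) =
    Set.range fun k : ℕ => ((1 + (κ : ℝ) / 2 + k : ℝ) : ℂ) := by
  refine subset_antisymm (fun E hE => ?_) ?_
  · obtain ⟨k, rfl⟩ := exists_nat_of_mem_eigenvaluesOn hE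
    exact ⟨k, rfl⟩
  · rw [← eigenvaluesOn_energy_ladderSpan_rankOne]
    exact eigenvaluesOn_mono _ (ladderSpan_rankOne_le_sector κ)

lemma ladderSpan_rankOne_le_finiteVectors {κ : ℕ} {V : Submodule ℂ Fuzzy}
    (hV : ladderSpan ℂ rankOne κ ≤ V) :
    ladderSpan ℂ rankOne κ ≤ finiteVectors (energy fundRep) V :=
  ladderSpan_le.2 fun _ _ h =>
    Submodule.subset_span ⟨hV (mem_ladderSpan h), _, energy_fundRep_rankOne h⟩

theorem finiteVectors_energy_sector (κ : ℕ) :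
    finiteVectors (energy fundRep) (sector κ) = ladderSpan ℂ rankOne κ := by
  refine le_antisymm (Submodule.span_le.2 ?_)
    (ladderSpan_rankOne_le_finiteVectors (ladderSpan_rankOne_le_sector κ))
  rintro Ψ ⟨hΨ, E, hE⟩
  rw [sector_eq_grade] at hΨ
  obtain rfl | h0 := eq_or_ne Ψ 0
  · exact zero_mem _
  have hN := (energy_fundRep_apply_eq_smul_iff hΨ).1 hE
  obtain ⟨k, hk⟩ := exists_nat_of_mul_numOp hN h0
  rw [hk] at hN
  refine Submodule.span_mono (Set.image_mono ?_) (mem_span_rankOne hΨ hN)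
  rintro ⟨p, q⟩ ⟨hq, hp⟩
  have hp : total p = k + κ := by exact_mod_cast hp
  simp only [Set.mem_ofPred_eq] at hq ⊢
  omega

theorem finiteVectors_energy_ladderSpan_rankOne (κ : ℕ) :
    finiteVectors (energy fundRep) (ladderSpan ℂ rankOne κ) = ladderSpan ℂ rankOne κ :=
  le_antisymm (Submodule.span_le.2 fun _ h => h.1) (ladderSpan_rankOne_le_finiteVectors le_rfl)

theorem isLeast_energy (κ : ℕ) :
    IsLeast (Complex.re '' eigenvaluesOn (energy fundRep) (ladderSpan ℂ rankOne κ))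
      (1 + (κ : ℝ) / 2) := by
  rw [eigenvaluesOn_energy_ladderSpan_rankOne, ← Set.range_comp]
  refine ⟨⟨0, by simp⟩, ?_⟩
  rintro _ ⟨k, rfl⟩
  simp

/-! ### Irreducibility -/

lemma monoSpan_eq_ladderSpan (κ : ℤ) : monoSpan κ = ladderSpan ℂ monomial κ := by
  refine le_antisymm (Submodule.span_le.2 ?_) (ladderSpan_le.2 fun n m h => ?_)
  · rintro _ ⟨n, m, h, rfl⟩
    exact mem_ladderSpan (by simpa [chirality, total] using h)
  · exact Submodule.subset_span ⟨n, m, by simpa [chirality, total] using h, rfl⟩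

lemma monoSpan_le_sector (κ : ℤ) : monoSpan κ ≤ sector κ := by
  rw [sector_eq_grade, monoSpan, Submodule.span_le]
  rintro _ ⟨n, m, rfl, rfl⟩
  exact monomial_mem_grade n m

lemma oscAdag_mul_oscA_mem_ladderSpan_rankOne {κ : ℤ} {Ψ : Fuzzy}
    (hΨ : Ψ ∈ ladderSpan ℂ rankOne κ) (i j : Fin 2 ⊕ Fin 2) :
    (oscAdag i * oscA j) Ψ ∈ ladderSpan ℂ rankOne κ := by
  have lower : oscA j Ψ ∈ ladderSpan ℂ rankOne (κ - 1) := by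
    rcases j with β | β
    exacts [isLadder_rankOne.dx_mem β hΨ, isLadder_rankOne.y_mem β hΨ]
  rw [← sub_add_cancel κ 1]
  rcases i with α | α
  exacts [isLadder_rankOne.x_mem α lower, isLadder_rankOne.dy_mem α lower]

lemma oscAdag_mul_oscA_mem_ladderSpan_monomial {κ : ℤ} {Ψ : Fuzzy}
    (hΨ : Ψ ∈ ladderSpan ℂ monomial κ) (i j : Fin 2 ⊕ Fin 2) :
    (oscAdag i * oscA j) Ψ ∈ ladderSpan ℂ monomial κ := by
  have lower : oscA j Ψ ∈ ladderSpan ℂ monomial (κ - 1) := by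
    have hy (β : Fin 2) : Ψ * ann β ∈ ladderSpan ℂ monomial (κ - 1) :=
      isLadder_monomial.y_mem β hΨ
    rcases j with β | β
    · simpa [oscA] using add_mem (isLadder_monomial.dx_mem β hΨ) (hy β)
    · exact hy β
  have hx (α : Fin 2) : cre α * oscA j Ψ ∈ ladderSpan ℂ monomial κ := by
    simpa using isLadder_monomial.x_mem α lower
  rcases i with α | α
  · exact hx α
  · have hdy : oscA j Ψ * cre α - cre α * oscA j Ψ ∈ ladderSpan ℂ monomial κ := by
      simpa [adCre] using isLadder_monomial.dy_mem α lower
    simpa [oscAdag] using add_mem hdy (hx α)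

theorem isIrred_fundRep_ladderSpan_rankOne (κ : ℕ) :
    IsIrred fundRep su22 (ladderSpan ℂ rankOne κ) := by
  refine ⟨fun X _ Ψ hΨ => fundRep_apply_mem (oscAdag_mul_oscA_mem_ladderSpan_rankOne hΨ) X,
    ladderSpan_ne_bot rankOne_ne_zero κ, fun U hle hU => ?_⟩
  have bilinear (i j) (Ψ) (hΨ : Ψ ∈ U) : oscAdag i (oscA j Ψ) ∈ U :=
    hU.oscAdag_mul_oscA_mem (hle.trans (ladderSpan_rankOne_le_grade κ)) hΨ i j
  exact isLadder_rankOne.eq_bot_or_eq_ladderSpan hle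
    (fun α β => bilinear (.inl α) (.inl β)) (fun α β => bilinear (.inl α) (.inr β))
    (fun α β => bilinear (.inr α) (.inl β)) (fun α β => bilinear (.inr α) (.inr β))

theorem isIrred_fundRep_monoSpan (κ : ℕ) : IsIrred fundRep su22 (monoSpan κ) := by
  have hgrade : monoSpan κ ≤ grade (κ : ℤ) := sector_eq_grade κ ▸ monoSpan_le_sector κ
  rw [monoSpan_eq_ladderSpan] at *
  refine ⟨fun X _ Ψ hΨ => fundRep_apply_mem (oscAdag_mul_oscA_mem_ladderSpan_monomial hΨ) X,
    ladderSpan_ne_bot monomial_ne_zero κ, fun U hle hU => ?_⟩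
  have bilinear (i j) (Ψ) (hΨ : Ψ ∈ U) : oscAdag i (oscA j Ψ) ∈ U :=
    hU.oscAdag_mul_oscA_mem (hle.trans hgrade) hΨ i j
  have hdx (i β) (Ψ) (hΨ : Ψ ∈ U) :
      oscAdag i ((LinearMap.mulLeft ℂ (ann β) - LinearMap.mulRight ℂ (ann β)) Ψ) ∈ U := by
    rw [LinearMap.sub_apply, map_sub]
    exact sub_mem (bilinear i (.inl β) Ψ hΨ) (bilinear i (.inr β) Ψ hΨ)
  exact isLadder_monomial.eq_bot_or_eq_ladderSpan hle
    (fun α β => hdx (.inl α) β) (fun α β => bilinear (.inl α) (.inr β))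
    (fun α β Ψ hΨ => sub_mem (hdx (.inr α) β Ψ hΨ) (hdx (.inl α) β Ψ hΨ))
    (fun α β Ψ hΨ => sub_mem (bilinear (.inr α) (.inr β) Ψ hΨ) (bilinear (.inl α) (.inr β) Ψ hΨ))

/-! ### The lowest energy space -/

/-- The lowest energy space: the span of the operators `(a†)ᵖ|0⟩⟨0|` with `p₁ + p₂ = κ`. -/
def lowestSpan (κ : ℕ) : Submodule ℂ Fuzzy :=
  Submodule.span ℂ ((fun p => rankOne p 0) '' {p | total p = κ})

lemma lowestSpan_le {κ : ℕ} {V : Submodule ℂ Fuzzy} :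
    lowestSpan κ ≤ V ↔ ∀ p, total p = κ → rankOne p 0 ∈ V := by
  rw [lowestSpan, Submodule.span_le, Set.image_subset_iff]
  rfl

lemma rankOne_zero_mem_lowestSpan {κ : ℕ} {p : Occ} (h : total p = κ) :
    rankOne p 0 ∈ lowestSpan κ :=
  Submodule.subset_span ⟨p, h, rfl⟩

lemma lowestSpan_ne_bot (κ : ℕ) : lowestSpan κ ≠ ⊥ :=
  (Submodule.ne_bot_iff _).2 ⟨rankOne (Pi.single 0 κ) 0,
    rankOne_zero_mem_lowestSpan (total_single 0 κ), rankOne_ne_zero _ _⟩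

lemma lowestSpan_le_ladderSpan (κ : ℕ) : lowestSpan κ ≤ ladderSpan ℂ rankOne κ :=
  lowestSpan_le.2 fun p hp => mem_ladderSpan (by simp [hp])

lemma mul_cre_of_mem_lowestSpan {κ : ℕ} {Ψ : Fuzzy} (hΨ : Ψ ∈ lowestSpan κ) (α : Fin 2) :
    Ψ * cre α = 0 := by
  have hle : lowestSpan κ ≤ LinearMap.ker (LinearMap.mulRight ℂ (cre α)) :=
    lowestSpan_le.2 fun p _ => by
      rw [LinearMap.mem_ker, (isLadder_rankOne.snd p).lower, Pi.zero_apply, Nat.cast_zero,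
        zero_smul]
  exact hle hΨ

lemma mul_numOp_of_mem_lowestSpan {κ : ℕ} {Ψ : Fuzzy} (hΨ : Ψ ∈ lowestSpan κ) :
    Ψ * numOp = 0 := by
  simp only [numOp, Finset.mul_sum, ← mul_assoc, mul_cre_of_mem_lowestSpan hΨ, zero_mul,
    Finset.sum_const_zero]

lemma numOp_mul_of_mem_lowestSpan {κ : ℕ} {Ψ : Fuzzy} (hΨ : Ψ ∈ lowestSpan κ) :
    numOp * Ψ = (κ : ℂ) • Ψ := by
  have hgrade := ladderSpan_rankOne_le_grade κ (lowestSpan_le_ladderSpan κ hΨ)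
  rw [mem_grade.1 hgrade, mul_numOp_of_mem_lowestSpan hΨ, zero_add, Int.cast_natCast]

theorem eigenspaceIn_energy (κ : ℕ) :
    eigenspaceIn (energy fundRep) (ladderSpan ℂ rankOne κ) ((1 + (κ : ℝ) / 2 : ℝ) : ℂ) =
      lowestSpan κ := by
  ext Ψ
  rw [eigenspaceIn, Submodule.mem_inf, LinearMap.mem_ker, LinearMap.sub_apply,
    LinearMap.smul_apply, LinearMap.id_apply, sub_eq_zero]
  refine ⟨fun ⟨hΨ, hE⟩ => ?_, fun hΨ => ⟨lowestSpan_le_ladderSpan κ hΨ, ?_⟩⟩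
  · have hgrade := ladderSpan_rankOne_le_grade κ hΨ
    have hN : Ψ * numOp = ((0 : ℕ) : ℂ) • Ψ := by
      rw [(energy_fundRep_apply_eq_smul_iff hgrade).1 hE]
      simp
    refine Submodule.span_le.2 ?_ (mem_span_rankOne hgrade hN)
    rintro _ ⟨⟨p, q⟩, ⟨hq, hp⟩, rfl⟩
    obtain rfl := total_eq_zero.1 hq
    exact rankOne_zero_mem_lowestSpan (by simpa using hp)
  · have hgrade := ladderSpan_rankOne_le_grade κ (lowestSpan_le_ladderSpan κ hΨ)
    rw [energy_fundRep_apply_eq_smul_iff hgrade, mul_numOp_of_mem_lowestSpan hΨ]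
    simp

lemma bil_inl_apply (A : Matrix (Fin 2) (Fin 2) ℂ) (Ψ : Fuzzy) :
    bil A (oscAdag ∘ Sum.inl) (oscA ∘ Sum.inl) Ψ = bil A cre ann * Ψ := by
  simp only [bil, oscAdag, oscA, Function.comp_apply, Sum.elim_inl, LinearMap.sum_apply,
    LinearMap.smul_apply, Module.End.mul_apply, LinearMap.mulLeft_apply, Finset.sum_mul,
    smul_mul_assoc, mul_assoc]

lemma bil_inr_apply_of_mem_lowestSpan {κ : ℕ} {Ψ : Fuzzy} (hΨ : Ψ ∈ lowestSpan κ)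
    (B : Matrix (Fin 2) (Fin 2) ℂ) :
    bil B (oscAdag ∘ Sum.inr) (oscA ∘ Sum.inr) Ψ = B.trace • Ψ := by
  have hδ (α β : Fin 2) : Ψ * ann β * cre α = (1 : Matrix (Fin 2) (Fin 2) ℂ) β α • Ψ := by
    rw [mul_assoc, ann_mul_cre, mul_add, ← mul_assoc, mul_cre_of_mem_lowestSpan hΨ, zero_mul,
      zero_add, mul_smul_comm, mul_one]
  simp only [bil, oscAdag, oscA, Function.comp_apply, Sum.elim_inr, LinearMap.sum_apply,
    LinearMap.smul_apply, Module.End.mul_apply, LinearMap.mulRight_apply, hδ, smul_smul,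
    ← Finset.sum_smul, Matrix.one_apply, mul_ite, mul_one, mul_zero, Finset.sum_ite_eq',
    Finset.mem_univ, if_true, Matrix.trace, Matrix.diag_apply]

lemma fundRep_fromBlocks_apply_of_mem_lowestSpan {κ : ℕ} {Ψ : Fuzzy} (hΨ : Ψ ∈ lowestSpan κ)
    (A B : Matrix (Fin 2) (Fin 2) ℂ) :
    fundRep (Matrix.fromBlocks A 0 0 B) Ψ = bil A cre ann * Ψ - B.trace • Ψ := by
  rw [fundRep_eq_oscRep, oscRep_fromBlocks, bil_zero, bil_zero, add_zero, zero_add,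
    LinearMap.sub_apply, bil_inl_apply, bil_inr_apply_of_mem_lowestSpan hΨ]

lemma exists_skewHermitian_add_smul {n : Type*} [Fintype n] {A : Matrix n n ℂ}
    (hA : A.trace = 0) :
    ∃ Y Z : Matrix n n ℂ, (Y.conjTranspose = -Y ∧ Y.trace = 0) ∧
      (Z.conjTranspose = -Z ∧ Z.trace = 0) ∧ A = Y + Complex.I • Z := by
  refine ⟨(1 / 2 : ℂ) • (A - A.conjTranspose), (-Complex.I / 2) • (A + A.conjTranspose),
    ⟨?_, ?_⟩, ⟨?_, ?_⟩, ?_⟩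
  · simp
    module
  · simp [hA]
  · simp
    module
  · simp [hA]
  · match_scalars <;> grind [Complex.I_sq]

lemma IsInvariant.bil_mul_mem {κ : ℕ} {U : Submodule ℂ Fuzzy} (hle : U ≤ lowestSpan κ)
    (hU : IsInvariant fundRep su2su2 U) {Ψ : Fuzzy} (hΨ : Ψ ∈ U) (A : Matrix (Fin 2) (Fin 2) ℂ) :
    bil A cre ann * Ψ ∈ U := by
  have hskew {Y : Matrix (Fin 2) (Fin 2) ℂ} (hY : Y.conjTranspose = -Y ∧ Y.trace = 0) :
      bil Y cre ann * Ψ ∈ U := by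
    have h := hU _ ⟨Y, 0, hY.1, hY.2, by simp, by simp, rfl⟩ Ψ hΨ
    rwa [fundRep_fromBlocks_apply_of_mem_lowestSpan (hle hΨ), Matrix.trace_zero, zero_smul,
      sub_zero] at h
  obtain ⟨Y, Z, hY, hZ, hYZ⟩ := exists_skewHermitian_add_smul (A := A - (A.trace / 2) • 1)
    (by simp)
  generalize A.trace / 2 = c at hYZ
  have hA : bil A cre ann = bil Y cre ann + Complex.I • bil Z cre ann + c • numOp := by
    rw [sub_eq_iff_eq_add.1 hYZ, numOp, ← bil_one]
    simp only [bil, Matrix.add_apply, Matrix.smul_apply, add_smul, smul_assoc,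
      Finset.sum_add_distrib, Finset.smul_sum]
  rw [hA, add_mul, add_mul, smul_mul_assoc, smul_mul_assoc, numOp_mul_of_mem_lowestSpan (hle hΨ)]
  exact add_mem (add_mem (hskew hY) (U.smul_mem _ (hskew hZ))) (U.smul_mem _ (U.smul_mem _ hΨ))

theorem isIrred_fundRep_lowestSpan (κ : ℕ) : IsIrred fundRep su2su2 (lowestSpan κ) := by
  refine ⟨?_, lowestSpan_ne_bot κ, fun U hle hU => ?_⟩
  · rintro _ ⟨A, B, -, -, -, -, rfl⟩ Ψ hΨ
    rw [fundRep_fromBlocks_apply_of_mem_lowestSpan hΨ]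
    refine sub_mem ?_ (Submodule.smul_mem _ _ hΨ)
    simp only [bil, Finset.sum_mul, smul_mul_assoc, mul_assoc]
    exact sum_mem fun α _ => sum_mem fun β _ => Submodule.smul_mem _ _
      ((isLadder_rankOne.fst 0).raise_lower_mem_span_total hΨ α β)
  · refine (isLadder_rankOne.fst 0).eq_bot_or_eq_span_total hle fun α β Ψ hΨ => ?_
    simpa [bil, Matrix.single_apply, ite_and, ite_smul, mul_assoc] using
      hU.bil_mul_mem hle hΨ (Matrix.single α β 1)

lemma sum_bil_pauli_sq_cre_ann :
    ∑ k, bil (pauli k) cre ann * bil (pauli k) cre ann = numOp * numOp + (2 : ℂ) • numOp := by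
  have hbil : bil 1 ann cre = numOp + (2 : ℂ) • 1 := by
    simp [bil_one, numOp, ann_mul_cre]
    module
  have hN (α : Fin 2) : bil 1 ann cre * ann α = ann α * (numOp + 1) := by
    rw [hbil, add_mul, mem_grade.1 (ann_mem_grade α), mul_add, smul_mul_assoc, one_mul, mul_one]
    module
  have hsum : ∑ α, cre α * (ann α * (numOp + 1)) = numOp * (numOp + 1) := by
    simp only [← mul_assoc, ← Finset.sum_mul, ← numOp.eq_def]
  rw [sum_bil_pauli_mul_bil_pauli, bil_one cre ann, ← numOp.eq_def]
  simp only [bil_one cre, hN, hsum]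
  rw [mul_add, mul_one]
  module

theorem hasSpins_fundRep (κ : ℕ) : HasSpins fundRep (lowestSpan κ) ((κ : ℝ) / 2) 0 := by
  refine ⟨isIrred_fundRep_lowestSpan κ, fun Ψ hΨ => ?_, fun Ψ hΨ => ?_⟩
  · have hhalf (k : Fin 3) (Φ : Fuzzy) : fundRep (.fromBlocks ((1 / 2 : ℂ) • pauli k) 0 0 0) Φ =
        (1 / 2 : ℂ) • (bil (pauli k) cre ann * Φ) := by
      rw [fundRep_eq_oscRep, oscRep_fromBlocks, bil_zero, bil_zero, bil_zero, add_zero, add_zero,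
        sub_zero, bil_inl_apply, bil_smul, smul_mul_assoc]
    have hsq (k : Fin 3) : (fundRep (.fromBlocks ((1 / 2 : ℂ) • pauli k) 0 0 0) *
        fundRep (.fromBlocks ((1 / 2 : ℂ) • pauli k) 0 0 0)) Ψ =
        (1 / 4 : ℂ) • (bil (pauli k) cre ann * bil (pauli k) cre ann * Ψ) := by
      rw [Module.End.mul_apply, hhalf, hhalf, mul_smul_comm, smul_smul, mul_assoc]
      norm_num
    rw [casimirLeft, LinearMap.sum_apply, Finset.sum_congr rfl fun k _ => hsq k,
      ← Finset.smul_sum, ← Finset.sum_mul, sum_bil_pauli_sq_cre_ann, add_mul, mul_assoc,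
      smul_mul_assoc, numOp_mul_of_mem_lowestSpan hΨ, mul_smul_comm,
      numOp_mul_of_mem_lowestSpan hΨ]
    push_cast
    module
  · have hzero (k : Fin 3) : fundRep (.fromBlocks 0 0 0 ((1 / 2 : ℂ) • pauli k)) Ψ = 0 := by
      rw [fundRep_fromBlocks_apply_of_mem_lowestSpan hΨ, bil_zero]
      fin_cases k <;> simp [pauli, Matrix.trace]
    simp only [casimirRight, LinearMap.sum_apply, Module.End.mul_apply, hzero, map_zero,
      Finset.sum_const_zero, zero_mul, Complex.ofReal_zero, zero_smul]

/-! ### The dual representation -/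

lemma neg_transpose_mem_su2su2 {X : Mat} (hX : X ∈ su2su2) : -X.transpose ∈ su2su2 := by
  have hskew {A : Matrix (Fin 2) (Fin 2) ℂ} (hA : A.conjTranspose = -A) :
      (-A.transpose).conjTranspose = -(-A.transpose) := by
    have hconj : A.transpose.conjTranspose = A.conjTranspose.transpose := rfl
    rw [Matrix.conjTranspose_neg, hconj, hA, Matrix.transpose_neg]
  obtain ⟨A, B, hA, htrA, hB, htrB, rfl⟩ := hX
  exact ⟨-A.transpose, -B.transpose, hskew hA, by simp [htrA], hskew hB, by simp [htrB],
    by simp [Matrix.fromBlocks_transpose, Matrix.fromBlocks_neg]⟩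

section Dual

variable {𝔤 : Set Mat} (h𝔤 : ∀ X ∈ 𝔤, -X.transpose ∈ 𝔤) {V : Submodule ℂ Fuzzy}
include h𝔤

lemma isInvariant_dualRep_iff : IsInvariant dualRep 𝔤 V ↔ IsInvariant fundRep 𝔤 V := by
  refine ⟨fun h X hX Ψ hΨ => ?_, fun h X hX Ψ hΨ => h _ (h𝔤 X hX) Ψ hΨ⟩
  simpa [dualRep] using h _ (h𝔤 X hX) Ψ hΨ

lemma isIrred_dualRep_iff : IsIrred dualRep 𝔤 V ↔ IsIrred fundRep 𝔤 V := by
  simp only [IsIrred, isInvariant_dualRep_iff h𝔤]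

end Dual

lemma dualRep_eq_neg {X : Mat} (hX : X.transpose = X) : dualRep X = -fundRep X := by
  rw [dualRep, hX, fundRep_eq_oscRep, map_neg]

lemma neg_energy_dualRep : -energy dualRep = energy fundRep := by
  have hS : (genS5 0).transpose = genS5 0 := by
    simp [genS5, gam_zero, Matrix.fromBlocks_transpose]
  rw [energy, energy, dualRep_eq_neg hS, smul_neg, neg_neg]

lemma dualRep_mul_self {X : Mat} (hX : X.transpose = X ∨ X.transpose = -X) :
    dualRep X * dualRep X = fundRep X * fundRep X := by
  rcases hX with hX | hX
  · rw [dualRep_eq_neg hX]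
    exact neg_mul_neg (fundRep X) (fundRep X)
  · rw [dualRep, hX, neg_neg]

lemma pauli_transpose (k : Fin 3) :
    (pauli k).transpose = pauli k ∨ (pauli k).transpose = -pauli k := by
  fin_cases k
  on_goal 2 => right
  on_goal 1 => left
  on_goal 3 => left
  all_goals
    ext i j
    fin_cases i <;> fin_cases j <;> simp [pauli]

lemma casimirLeft_dualRep : casimirLeft dualRep = casimirLeft fundRep := by
  refine Finset.sum_congr rfl fun k _ => dualRep_mul_self ?_
  rcases pauli_transpose k with h | h <;>
    simp [Matrix.fromBlocks_transpose, Matrix.fromBlocks_neg, h]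

lemma casimirRight_dualRep : casimirRight dualRep = casimirRight fundRep := by
  refine Finset.sum_congr rfl fun k _ => dualRep_mul_self ?_
  rcases pauli_transpose k with h | h <;>
    simp [Matrix.fromBlocks_transpose, Matrix.fromBlocks_neg, h]

lemma HasSpins.dualRep {V : Submodule ℂ Fuzzy} {j₁ j₂ : ℝ} (h : HasSpins fundRep V j₁ j₂) :
    HasSpins dualRep V j₁ j₂ := by
  rwa [HasSpins, isIrred_dualRep_iff fun _ => neg_transpose_mem_su2su2, casimirLeft_dualRep,
    casimirRight_dualRep]

lemma IsUnitaryLowestWeight.dualRep {H : Module.End ℂ Fuzzy} {V : Submodule ℂ Fuzzy}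
    {d j₁ j₂ : ℝ} (h : IsUnitaryLowestWeight fundRep H V d j₁ j₂) :
    IsUnitaryLowestWeight dualRep H V d j₁ j₂ where
  irred := (isIrred_dualRep_iff fun _ => neg_transpose_mem_su22).2 h.irred
  hilbertSchmidt := h.hilbertSchmidt
  unitary _ hX := h.unitary _ (neg_transpose_mem_su22 hX)
  spanned := h.spanned
  real := h.real
  lowest := h.lowest
  lowestSpins := h.lowestSpins.dualRep

/-! ### The massless fields -/

attribute [local instance 100] LieRing.ofAssociativeRing in
lemma IsOscillator.exists_lieHom {u v : Fin 2 ⊕ Fin 2 → Module.End ℂ Fuzzy}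
    (h : IsOscillator u v) :
    ∃ φ : su22 →ₗ⁅ℝ⁆ Module.End ℂ Fuzzy, ∀ X : su22, φ X = oscRep u v X :=
  ⟨{ toFun X := oscRep u v X
     map_add' X Y := map_add (oscRep u v) (X : Mat) Y
     map_smul' r X := map_smul (oscRep u v) (r : ℂ) (X : Mat)
     map_lie' {X Y} := (h.oscRep_commutator X Y).symm }, fun _ => rfl⟩

theorem isUnitaryLowestWeight_fundRep (κ : ℕ) :
    IsUnitaryLowestWeight fundRep (energy fundRep) (ladderSpan ℂ rankOne κ)
      (1 + (κ : ℝ) / 2) ((κ : ℝ) / 2) 0 where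
  irred := isIrred_fundRep_ladderSpan_rankOne κ
  hilbertSchmidt _ hΨ := isHS_of_mem_rankOneSpan (ladderSpan_rankOne_le_rankOneSpan κ hΨ)
  unitary _ hX _ hΨ Φ _ := hsInner_fundRep hX (ladderSpan_rankOne_le_rankOneSpan κ hΨ) Φ
  spanned := finiteVectors_energy_ladderSpan_rankOne κ
  real E hE := by
    rw [eigenvaluesOn_energy_ladderSpan_rankOne] at hE
    obtain ⟨k, rfl⟩ := hE
    exact Complex.ofReal_im _
  lowest := isLeast_energy κ
  lowestSpins := (eigenspaceIn_energy κ).symm ▸ hasSpins_fundRep κ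

lemma sector_natCast_eq_grade (κ : ℕ) : sector κ = grade ((κ : ℝ) : ℂ) := by
  simp [sector_eq_grade]

theorem isMasslessField_fundRep (κ : ℕ) :
    IsMasslessField fundRep κ (energy fundRep) ((κ : ℝ) / 2) where
  representation := fundRep_eq_oscRep ▸ isOscillator_osc.exists_lieHom
  span_le := monoSpan_le_sector κ
  span_irred := isIrred_fundRep_monoSpan κ
  sector_invariant X _ Ψ hΨ := by
    rw [sector_eq_grade] at hΨ ⊢
    exact fundRep_mem_grade hΨ X
  massless Ψ _ := by rw [massSq_fundRep, LinearMap.zero_apply]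
  pauliLub_null Ψ hΨ := by
    rw [sector_natCast_eq_grade] at hΨ
    rw [(hasHelicity_fundRep κ).pauliLubSq_apply (fun μ _ hΦ => fundRep_mem_grade hΦ _) hΨ,
      massSq_fundRep, LinearMap.zero_apply, smul_zero]
  helicity := sector_natCast_eq_grade κ ▸ hasHelicity_fundRep κ
  spectrum := eigenvaluesOn_energy_sector κ
  doubleton := (finiteVectors_energy_sector κ).symm ▸ isUnitaryLowestWeight_fundRep κ

theorem isMasslessField_dualRep (κ : ℕ) :
    IsMasslessField dualRep κ (-energy dualRep) (-((κ : ℝ) / 2)) := by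
  rw [neg_energy_dualRep]
  have hfund := isMasslessField_fundRep κ
  exact
  { representation := by
      obtain ⟨φ, hφ⟩ := isOscillator_osc.canonical.exists_lieHom
      exact ⟨φ, fun X => (hφ X).trans (dualRep_eq_oscRep X.2.2).symm⟩
    span_le := hfund.span_le
    span_irred := (isIrred_dualRep_iff fun _ => neg_transpose_mem_su22).2 hfund.span_irred
    sector_invariant :=
      (isInvariant_dualRep_iff fun _ => neg_transpose_mem_su22).2 hfund.sector_invariant
    massless := fun Ψ _ => by rw [massSq_dualRep, LinearMap.zero_apply]
    pauliLub_null := fun Ψ hΨ => by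
      rw [sector_natCast_eq_grade] at hΨ
      rw [(hasHelicity_dualRep κ).pauliLubSq_apply (fun μ _ hΦ => fundRep_mem_grade hΦ _) hΨ,
        massSq_dualRep, LinearMap.zero_apply, smul_zero]
    helicity := sector_natCast_eq_grade κ ▸ hasHelicity_dualRep κ
    spectrum := hfund.spectrum
    doubleton := hfund.doubleton.dualRep }

end FuzzyDoubleton

theorem theorem2 (κ : ℕ) :
    FuzzyDoubleton.IsMasslessField FuzzyDoubleton.fundRep κ
      (FuzzyDoubleton.energy FuzzyDoubleton.fundRep) ((κ : ℝ) / 2) ∧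
    FuzzyDoubleton.IsMasslessField FuzzyDoubleton.dualRep κ
      (-FuzzyDoubleton.energy FuzzyDoubleton.dualRep) (-((κ : ℝ) / 2)) :=
  ⟨FuzzyDoubleton.isMasslessField_fundRep κ, FuzzyDoubleton.isMasslessField_dualRep κ⟩
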